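/- Let $k$ be an algebraically closed field of characteristic $0$. A plane curve $C_f$ is given by a non-constant polynomial $f\in k[x,y]$, and $V(f)\subseteq\mathbb A^2(k)$ is its set of points. For $f\neq 0$ and $P=(p_1,p_2)\in\mathbb A^2(k)$ let $m_P(f)$ be the least degree of a nonzero term of the Taylor expansion of $f$ at $P$, let the lowest form of $f$ at $P$ be the part of that degree, and let the tangents of $C_f$ at $P$ be the lines through $P$ corresponding to the linear factors of the lowest form. Two curves $C_f,C_g$ share a component through $P$ if $f$ and $g$ have a common irreducible factor that vanishes at $P$. For an affine change of coordinates $\varphi$ put $f^\varphi=f\circ\varphi^{-1}$. Blowup number. Let $P\in\mathbb A^2(k)$, let $f,g\in k[x,y]$, and consider the blowup of $\mathbb A^2$ at $P$, with exceptional line $\mathbb P^1$. Put $m=m_P(f)$. The strict transform $f'$ of $f\neq 0$ is given by $f'(x,y)=x^{-m}f(p_1+x,\,p_2+xy)$ in the chart in which the point $(1:z)$ of the exceptional line has the coordinates $(0,z)$, and by $f'(x,y)=y^{-m}f(p_1+xy,\,p_2+y)$ in the chart in which the point $(0:1)$ has the coordinates $(0,0)$. The first order infinitely near points of $C_f$ at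 $P$ are the points of the exceptional line that lie on the strict transform of $C_f$. The number $\mathcal B_P(f,g)\in\mathbb N\cup\{\infty\}$ is defined recursively by $$\mathcal B_P(f,g)=\begin{cases}\infty&\text{if } C_f \text{ and } C_g \text{ share a component through } P,\\ 0&\text{if } P\notin V(f)\cap V(g),\\ m_P(f)\,m_P(g)+\sum_Q\mathcal B_Q(f',g')&\text{otherwise,}\end{cases}$$ where $Q$ runs over the (finitely many) first order infinitely near points at $P$ common to $C_f$ and $C_g$, each taken once, and $f',g'$ are the strict transforms in the chart used for $Q$. (Precisely, $\mathcal B_P(f,g)$ is the supremum over $n$ of the values obtained by cutting off this recursion at depth $n$, with the value $0$ there; it satisfies the recursion.) Theorem. There is exactly one function $I$ that assigns to each point $P\in\mathbb A^2(k)$ and all non-constant $f,g\in k[x,y]$ a value $I_P(f,g)\in\mathbb N\cup\{\infty\}$ such that the following holds for all $P$ and all polynomials for which the expressions are defined: 1. $I_P(f,g)=\infty$ if and only if $C_f$ and $C_g$ share a component through $P$; 2. $I_P(f,g)=0$ if and only if $P\notin V(f)$ or $P\notin V(g)$; 3. $I_P(f,g)=I_{\varphi(P)}(f^\varphi,g^\varphi)$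 for each affine change of coordinates $\varphi$; 4. $I_P(f,g)=I_P(g,f)$; 5. $I_P(f,g)\ge m_P(f)\,m_P(g)$, with equality if and only if $C_f$ and $C_g$ have no common tangent at $P$; 6. $I_P(f_1f_2,g)=I_P(f_1,g)+I_P(f_2,g)$; 7. $I_P(f,g)=I_P(f,g+hf)$ for each $h\in k[x,y]$. This function, Fulton's intersection number, is the blowup number: for all non-constant $f,g\in k[x,y]$ and all $P\in\mathbb A^2(k)$, $$\mathcal B_P(f,g)=I_P(f,g).$$ -/

import Mathlib

open MvPolynomial

noncomputable section

namespace PlaneIntersection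

variable {k : Type*} [Field k]

/-- The polynomial `f(x + p₁, y + p₂)`: its homogeneous components are the terms of the Taylor
expansion of `f` at `P = (p₁, p₂)`. -/
def translate (P : Fin 2 → k) (f : MvPolynomial (Fin 2) k) : MvPolynomial (Fin 2) k :=
  aeval (fun i => X i + C (P i)) f

/-- The multiplicity `m_P(f)`: the least degree of a nonzero term of the Taylor expansion of
`f` at `P` (for `f ≠ 0`). -/
def mult (P : Fin 2 → k) (f : MvPolynomial (Fin 2) k) : ℕ :=
  sInf {d | homogeneousComponent d (translate P f) ≠ 0}

/-- The form of lowest degree in the Taylor expansion of `f` at `P`. -/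
def lowestForm (P : Fin 2 → k) (f : MvPolynomial (Fin 2) k) : MvPolynomial (Fin 2) k :=
  homogeneousComponent (mult P f) (translate P f)

/-- The curves `f = 0` and `g = 0` have a common tangent line at `P`: the lowest forms of `f`
and `g` at `P` have a common linear factor. -/
def HaveCommonTangent (P : Fin 2 → k) (f g : MvPolynomial (Fin 2) k) : Prop :=
  ∃ a b : k, (a ≠ 0 ∨ b ≠ 0) ∧
    (C a * X 0 + C b * X 1) ∣ lowestForm P f ∧ (C a * X 0 + C b * X 1) ∣ lowestForm P g

/-- The curves `f = 0` and `g = 0` share a component passing through `P`. -/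
def ShareComponent (P : Fin 2 → k) (f g : MvPolynomial (Fin 2) k) : Prop :=
  ∃ h : MvPolynomial (Fin 2) k, Irreducible h ∧ h ∣ f ∧ h ∣ g ∧ eval P h = 0

/-- The polynomial `f ∘ φ⁻¹` for an affine change of coordinates `φ` of the plane. -/
def affineTransform (φ : (Fin 2 → k) ≃ᵃ[k] (Fin 2 → k)) (f : MvPolynomial (Fin 2) k) :
    MvPolynomial (Fin 2) k :=
  aeval (fun i => C (φ.symm 0 i) + ∑ j, C (φ.symm.linear (Pi.single j 1) i) * X j) f

variable (k) in
/-- Plane curves are given by non-constant polynomials. -/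
abbrev PlaneCurve : Type _ :=
  {f : MvPolynomial (Fin 2) k // ∀ c : k, f ≠ C c}

/-- Fulton's seven properties of the local intersection number of plane curves. -/
structure IsFultonIntersectionNumber
    (I : (Fin 2 → k) → PlaneCurve k → PlaneCurve k → ℕ∞) : Prop where
  eq_top_iff : ∀ P f g, I P f g = ⊤ ↔ ShareComponent P f.1 g.1
  eq_zero_iff : ∀ P f g, I P f g = 0 ↔ eval P f.1 ≠ 0 ∨ eval P g.1 ≠ 0
  affine : ∀ (φ : (Fin 2 → k) ≃ᵃ[k] (Fin 2 → k)) (P : Fin 2 → k) (f g f' g' : PlaneCurve k),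
    f'.1 = affineTransform φ f.1 → g'.1 = affineTransform φ g.1 →
      I P f g = I (φ P) f' g'
  symm : ∀ P f g, I P f g = I P g f
  mult_le : ∀ P f g, ((mult P f.1 * mult P g.1 : ℕ) : ℕ∞) ≤ I P f g
  eq_mult_iff : ∀ P f g, I P f g = ((mult P f.1 * mult P g.1 : ℕ) : ℕ∞) ↔
    ¬ HaveCommonTangent P f.1 g.1
  mul : ∀ (P : Fin 2 → k) (f f₁ f₂ g : PlaneCurve k), f.1 = f₁.1 * f₂.1 →
    I P f g = I P f₁ g + I P f₂ g
  add_mul : ∀ (P : Fin 2 → k) (f g g' : PlaneCurve k) (h : MvPolynomial (Fin 2) k),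
    g'.1 = g.1 + h * f.1 → I P f g = I P f g'

/-- Local equation of the strict transform of `f = 0` under the blowup of the plane at `P`, in
an affine chart around a point of the exceptional line `ℙ¹`. The points of the exceptional line
are encoded by `Option k`: `some z` is the point `(1 : z)` and `none` is the point `(0 : 1)`.

With coordinates translated such that `P` is the origin and with `m = m_P(f)`, the strict
transform is `f(x, xy) / x ^ m` in the chart of the points `(1 : z)`, and `f(xy, y) / y ^ m` in
the chart around `(0 : 1)`. Both divisions are exact. -/
def strictTransform (P : Fin 2 → k) (f : MvPolynomial (Fin 2) k) :
    Option k → MvPolynomial (Fin 2) k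
  | some _ => (aeval ![X 0, X 0 * X 1] (translate P f) : MvPolynomial (Fin 2) k).divMonomial
      (Finsupp.single 0 (mult P f))
  | none => (aeval ![X 0 * X 1, X 1] (translate P f) : MvPolynomial (Fin 2) k).divMonomial
      (Finsupp.single 1 (mult P f))

/-- The coordinates of a point of the exceptional line, in the chart used for it in
`strictTransform`. -/
def chartPoint : Option k → (Fin 2 → k)
  | some z => ![0, z]
  | none => ![0, 0]

/-- The first order infinitely near points at `P` common to `f = 0` and `g = 0`: the points of
the exceptional line that lie on both strict transforms. -/
def commonNearPoints (P : Fin 2 → k) (f g : MvPolynomial (Fin 2) k) : Set (Option k) :=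
  {Q | eval (chartPoint Q) (strictTransform P f Q) = 0 ∧
    eval (chartPoint Q) (strictTransform P g Q) = 0}

open Classical in
/-- The right hand side of the recursion that defines the blowup number. -/
def blowupStep
    (B : (Fin 2 → k) → MvPolynomial (Fin 2) k → MvPolynomial (Fin 2) k → ℕ∞)
    (P : Fin 2 → k) (f g : MvPolynomial (Fin 2) k) : ℕ∞ :=
  if ShareComponent P f g then ⊤
  else if ¬ (eval P f = 0 ∧ eval P g = 0) then 0
  else ((mult P f * mult P g : ℕ) : ℕ∞) +
    ∑ᶠ Q ∈ commonNearPoints P f g,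
      B (chartPoint Q) (strictTransform P f Q) (strictTransform P g Q)

/-- The recursion for the blowup number, cut off at depth `n`. -/
def blowupApprox : ℕ → (Fin 2 → k) → MvPolynomial (Fin 2) k → MvPolynomial (Fin 2) k → ℕ∞
  | 0 => fun _ _ _ => 0
  | n + 1 => blowupStep (blowupApprox n)

/-- The blowup number `B_P(f, g)`, the least solution of the recursion `B = blowupStep B`; that
it solves the recursion is `blowupNumber_eq` below. -/
def blowupNumber (P : Fin 2 → k) (f g : MvPolynomial (Fin 2) k) : ℕ∞ :=
  ⨆ n, blowupApprox n P f g

theorem translate_ne_zero (P : Fin 2 → k) {f : MvPolynomial (Fin 2) k} (hf : f ≠ 0) :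
    translate P f ≠ 0 := by
  intro h
  apply hf
  have h2 : translate (-P) (translate P f) = f := by
    unfold translate
    rw [← AlgHom.comp_apply, comp_aeval]
    have : (fun i => (aeval fun i => X i + C ((-P) i)) (X i + C (P i))) =
        (X : Fin 2 → MvPolynomial (Fin 2) k) := by
      funext i
      rw [map_add, aeval_X, ← algebraMap_eq, AlgHom.commutes, algebraMap_eq]
      simp
    rw [this, aeval_X_left_apply]
  rw [← h2, h]
  simp [translate]

theorem lowestForm_ne_zero (P : Fin 2 → k) {f : MvPolynomial (Fin 2) k} (hf : f ≠ 0) :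
    lowestForm P f ≠ 0 := by
  have hne : {d | homogeneousComponent d (translate P f) ≠ 0}.Nonempty := by
    by_contra hc
    rw [Set.not_nonempty_iff_eq_empty, Set.eq_empty_iff_forall_notMem] at hc
    simp only [Set.mem_ofPred_eq, not_not] at hc
    apply translate_ne_zero P hf
    rw [← sum_homogeneousComponent (translate P f)]
    exact Finset.sum_eq_zero fun i _ => hc i
  exact Nat.sInf_mem hne

theorem coeff_chart (p : MvPolynomial (Fin 2) k) (d : Fin 2 →₀ ℕ) :
    coeff (Finsupp.single 0 (d 0 + d 1) + Finsupp.single 1 (d 1))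
      (aeval ![X 0, X 0 * X 1] p : MvPolynomial (Fin 2) k) = coeff d p := by
  induction p using MvPolynomial.induction_on' with
  | monomial e c =>
    have h1 : (aeval ![X 0, X 0 * X 1] (monomial e c) : MvPolynomial (Fin 2) k) =
        monomial (Finsupp.single 0 (e 0 + e 1) + Finsupp.single 1 (e 1)) c := by
      rw [aeval_monomial, Finsupp.prod_fintype _ _ (fun i => pow_zero _), Fin.prod_univ_two,
        algebraMap_eq, monomial_eq,
        Finsupp.prod_fintype _ _ (fun i => pow_zero _), Fin.prod_univ_two]
      simp only [Matrix.cons_val_zero, Matrix.cons_val_one, Finsupp.add_apply,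
        Finsupp.single_eq_same, Finsupp.single_apply]
      simp only [Fin.isValue, zero_ne_one, one_ne_zero, if_false, add_zero, zero_add]
      ring
    rw [h1, coeff_monomial, coeff_monomial]
    congr 1
    apply propext
    constructor
    · intro h
      have h0 := DFunLike.congr_fun h 0
      have h1 := DFunLike.congr_fun h 1
      simp at h0 h1
      ext i
      fin_cases i
      · simp; omega
      · simpa using h1
    · rintro rfl
      rfl
  | add p q hp hq => rw [map_add, coeff_add, coeff_add, hp, hq]

theorem coeff_exceptional (p : MvPolynomial (Fin 2) k) (j : ℕ) :
    (aeval ![0, Polynomial.X] p : Polynomial k).coeff j = coeff (Finsupp.single 1 j) p := by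
  induction p using MvPolynomial.induction_on' with
  | monomial e c =>
    rw [aeval_monomial, Finsupp.prod_fintype _ _ (fun i => pow_zero _), Fin.prod_univ_two,
      coeff_monomial, Polynomial.algebraMap_eq, Polynomial.coeff_C_mul]
    have key : e = Finsupp.single 1 j ↔ e 0 = 0 ∧ e 1 = j := by
      constructor
      · rintro rfl
        simp
      · rintro ⟨h0, h1⟩
        ext i
        fin_cases i
        · simpa using h0
        · simpa using h1
    simp only [key]
    by_cases h0 : e 0 = 0 <;> by_cases h1 : j = e 1 <;>
      simp [h0, h1, Polynomial.coeff_X_pow, eq_comm]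
  | add p q hp hq => rw [map_add, Polynomial.coeff_add, coeff_add, hp, hq]

/-- A curve has only finitely many first order infinitely near points. -/
theorem commonNearPoints_finite (P : Fin 2 → k) {f : MvPolynomial (Fin 2) k} (hf : f ≠ 0)
    (g : MvPolynomial (Fin 2) k) : (commonNearPoints P f g).Finite := by
  set f' : MvPolynomial (Fin 2) k := (aeval ![X 0, X 0 * X 1] (translate P f) :
    MvPolynomial (Fin 2) k).divMonomial (Finsupp.single 0 (mult P f)) with hf'
  have hq : (aeval ![0, Polynomial.X] f' : Polynomial k) ≠ 0 := by
    obtain ⟨d, hd⟩ := ne_zero_iff.1 (lowestForm_ne_zero P hf)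
    rw [lowestForm, coeff_homogeneousComponent] at hd
    split_ifs at hd with hdeg
    · intro h0
      apply hd
      have h1 := coeff_exceptional f' (d 1)
      rw [h0, Polynomial.coeff_zero, hf', coeff_divMonomial] at h1
      rw [← coeff_chart, h1]
      congr 3
      rw [← hdeg, Finsupp.degree_eq_sum, Fin.sum_univ_two]
    · exact absurd rfl hd
  have hev : ∀ z : k, (aeval ![0, Polynomial.X] f' : Polynomial k).eval z =
      eval ![0, z] f' := by
    intro z
    rw [← Polynomial.coe_evalRingHom, aeval_def, hom_eval₂]
    have h1 : (Polynomial.evalRingHom z).comp (algebraMap k (Polynomial k)) = RingHom.id k := by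
      ext
      simp
    rw [h1, eval₂_id]
    congr 1
    congr 1
    funext i
    fin_cases i <;> simp
  have hfin : {z : k | eval ![0, z] f' = 0}.Finite := by
    refine (Polynomial.finite_setOfPred_isRoot hq).subset fun z hz => ?_
    rw [Set.mem_ofPred_eq, Polynomial.IsRoot.def, hev]
    exact hz
  refine ((hfin.image some).union (Set.finite_singleton none)).subset ?_
  rintro (_ | z) hz
  · simp
  · left
    exact ⟨z, hz.1, rfl⟩

theorem shareComponent_zero_left {P : Fin 2 → k} {g : MvPolynomial (Fin 2) k}
    (hg : eval P g = 0) : ShareComponent P 0 g := by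
  have hmem : ∀ p : MvPolynomial (Fin 2) k, p ≠ 0 → eval P p = 0 →
      ∃ h, Irreducible h ∧ h ∣ p ∧ eval P h = 0 := by
    intro p
    induction p using WfDvdMonoid.induction_on_irreducible with
    | zero => exact fun h => absurd rfl h
    | unit u hu =>
      intro _ h
      exact absurd h (hu.map (eval P)).ne_zero
    | mul a i ha hi ih =>
      intro _ h
      rw [map_mul, mul_eq_zero] at h
      rcases h with h | h
      · exact ⟨i, hi, dvd_mul_right _ _, h⟩
      · obtain ⟨q, hq, hqa, hqP⟩ := ih ha h
        exact ⟨q, hq, hqa.mul_left _, hqP⟩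
  by_cases h0 : g = 0
  · subst h0
    have hX : (X 0 - C (P 0) : MvPolynomial (Fin 2) k) ≠ 0 := by
      intro h
      have h1 := congrArg (eval (P + 1)) h
      simp at h1
    obtain ⟨h, hi, -, he⟩ := hmem _ hX (by simp)
    exact ⟨h, hi, dvd_zero _, dvd_zero _, he⟩
  · obtain ⟨h, hi, hd, he⟩ := hmem g h0 hg
    exact ⟨h, hi, dvd_zero _, hd, he⟩

theorem blowupStep_mono
    {B B' : (Fin 2 → k) → MvPolynomial (Fin 2) k → MvPolynomial (Fin 2) k → ℕ∞}
    (h : ∀ P f g, B P f g ≤ B' P f g) (P : Fin 2 → k) (f g : MvPolynomial (Fin 2) k) :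
    blowupStep B P f g ≤ blowupStep B' P f g := by
  unfold blowupStep
  split_ifs with h1 h2
  · exact le_rfl
  · have hf : f ≠ 0 := by
      rintro rfl
      exact h1 (shareComponent_zero_left h2.2)
    rw [finsum_mem_eq_finite_toFinset_sum _ (commonNearPoints_finite P hf g),
      finsum_mem_eq_finite_toFinset_sum _ (commonNearPoints_finite P hf g)]
    gcongr
    exact h _ _ _
  · exact le_rfl

theorem blowupApprox_mono (P : Fin 2 → k) (f g : MvPolynomial (Fin 2) k) :
    Monotone fun n => blowupApprox n P f g := by
  refine monotone_nat_of_le_succ fun n => ?_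
  induction n generalizing P f g with
  | zero => exact bot_le
  | succ n ih => exact blowupStep_mono ih P f g

/-- The blowup number satisfies its defining recursion. -/
theorem blowupNumber_eq (P : Fin 2 → k) (f g : MvPolynomial (Fin 2) k) :
    blowupNumber P f g = blowupStep blowupNumber P f g := by
  have hlim : ∀ P f g, Filter.Tendsto (fun n => blowupApprox n P f g) Filter.atTop
      (nhds (blowupNumber (k := k) P f g)) := fun P f g =>
    tendsto_atTop_iSup (blowupApprox_mono P f g)
  have h1 := (Filter.tendsto_add_atTop_iff_nat 1).2 (hlim P f g)
  refine tendsto_nhds_unique h1 ?_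
  change Filter.Tendsto (fun n => blowupStep (blowupApprox n) P f g) _ _
  unfold blowupStep
  split_ifs with h1 h2
  · exact tendsto_const_nhds
  · have hf : f ≠ 0 := by
      rintro rfl
      exact h1 (shareComponent_zero_left h2.2)
    simp only [finsum_mem_eq_finite_toFinset_sum _ (commonNearPoints_finite P hf g)]
    exact tendsto_const_nhds.add (tendsto_finsetSum _ fun Q _ => hlim _ _ _)
  · exact tendsto_const_nhds

end PlaneIntersection

end

open MvPolynomial

noncomputable section

namespace PlaneIntersection

variable {k : Type*} [Field k]

/-! ### Translations and charts of the blowup -/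

/-! The blowup number itself is shown to have Fulton's properties, and an axiomatic uniqueness
argument then identifies it with every other function that has them.

Existence. In a chart with exceptional equation `E`, the pull-back of `f` is `E ^ m` times the
strict transform `f'`, and on `E = 0` the strict transform is the dehomogenized lowest form
(`chartMap_translate`, `exists_strictTransform_eq`). Hence multiplicities add, strict transforms
multiply, and near points are tangent directions; additivity, the bound by `m_P(f) m_P(g)` and its
equality case can be read off from the recursion. The hard property is invariance under `g ↦ g + h
f`, because the multiplicity of `g` may jump. The remedy is that `f'` meets the exceptional line in
exactly `m_P(f)` points (`finsum_blowupNumber_excVar`). If `m_P(g) = n + a`, the surplus `a m_P(f)`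
can be moved into the sum by replacing `g'` with `E ^ a g'`. With `n` the smaller of the
multiplicities of `g` and `G = g + h f = 0`, where `m_P(G) = n + b`, the polynomials `E ^ a g'` and
`E ^ b G'` differ by a multiple of `f'`, and induction on the finite value applies
(`blowupNumber_add_mul_of_eq_coe`).

Uniqueness. At a fixed point, vanishing off the point, symmetry, additivity, invariance under adding
multiples and the value 1 on the axes already determine all values for curves without a common
component there, and force them to be finite. This is the Euclidean algorithm in `k[x][y]`
(`AgreeFinite.of_not_dvd`). It is used three times: for the blowup number against itself, giving
finiteness; against its transport by an affine map, giving affine invariance; and against an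
arbitrary Fulton number, giving the theorem. -/

/-- The equation of the exceptional line in the chart used for `Q`. -/
def excVar : Option k → MvPolynomial (Fin 2) k
  | some _ => X 0
  | none => X 1

/-- The chart of the blowup of the origin used for `Q`. -/
def chartMap : Option k → (MvPolynomial (Fin 2) k →ₐ[k] MvPolynomial (Fin 2) k)
  | some _ => aeval ![X 0, X 0 * X 1]
  | none => aeval ![X 0 * X 1, X 1]

/-- Dehomogenization in the chart used for `Q`. -/
def dehomog : Option k → (MvPolynomial (Fin 2) k →ₐ[k] MvPolynomial (Fin 2) k)
  | some _ => aeval ![1, X 1]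
  | none => aeval ![X 0, 1]

/-- Homogeneous coordinates of a point of the exceptional line. -/
def direction : Option k → (Fin 2 → k)
  | some z => ![1, z]
  | none => ![0, 1]

/-- Restriction to the exceptional line in the chart used for `Q`. -/
def excRestrict : Option k → (MvPolynomial (Fin 2) k →ₐ[k] Polynomial k)
  | some _ => aeval ![0, Polynomial.X]
  | none => aeval ![Polynomial.X, 0]

theorem excVar_ne_zero (Q : Option k) : excVar Q ≠ 0 := by
  cases Q <;> exact X_ne_zero _

theorem eval_chartPoint_excVar (Q : Option k) : eval (chartPoint Q) (excVar Q) = 0 := by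
  cases Q <;> simp [chartPoint, excVar]

theorem excRestrict_excVar (Q : Option k) : excRestrict Q (excVar Q) = 0 := by
  cases Q <;> simp [excRestrict, excVar]

theorem translate_mul (P : Fin 2 → k) (f g : MvPolynomial (Fin 2) k) :
    translate P (f * g) = translate P f * translate P g := map_mul _ _ _

theorem translate_add (P : Fin 2 → k) (f g : MvPolynomial (Fin 2) k) :
    translate P (f + g) = translate P f + translate P g := map_add _ _ _

theorem eval_translate (P Q : Fin 2 → k) (f : MvPolynomial (Fin 2) k) :
    eval Q (translate P f) = eval (Q + P) f := by
  have : (aeval Q : MvPolynomial (Fin 2) k →ₐ[k] k).comp (aeval fun i => X i + C (P i)) =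
      aeval (Q + P) := by
    ext i
    simp
  exact DFunLike.congr_fun this f

theorem add_eq_of_coeff_ne_zero {F : MvPolynomial (Fin 2) k} {d : ℕ} (hF : F.IsHomogeneous d)
    {s : Fin 2 →₀ ℕ} (hs : coeff s F ≠ 0) : s 0 + s 1 = d := by
  have := hF hs
  rwa [Pi.one_def, ← Finsupp.degree_eq_weight_one, Finsupp.degree_eq_sum, Fin.sum_univ_two] at this

/-- Both chart coordinates are `E` times the dehomogenized ones, and a form of degree `d` scales by
`E ^ d`. -/
theorem chartMap_of_isHomogeneous (Q : Option k) {F : MvPolynomial (Fin 2) k} {d : ℕ}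
    (hF : F.IsHomogeneous d) : chartMap Q F = excVar Q ^ d * dehomog Q F := by
  have key : ∀ v : Fin 2 → MvPolynomial (Fin 2) k, ∀ e : MvPolynomial (Fin 2) k,
      aeval (fun i => e * v i) F = e ^ d * aeval v F := by
    intro v e
    rw [aeval_def, aeval_def, eval₂_eq', eval₂_eq', Finset.mul_sum]
    refine Finset.sum_congr rfl fun s hs => ?_
    have hd := add_eq_of_coeff_ne_zero hF (mem_support_iff.1 hs)
    rw [Fin.prod_univ_two, Fin.prod_univ_two, ← hd]
    ring
  cases Q with
  | none =>
    rw [chartMap, excVar, dehomog, ← key]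
    congr 2
    funext i
    fin_cases i <;> simp [mul_comm]
  | some z =>
    rw [chartMap, excVar, dehomog, ← key]
    congr 2
    funext i
    fin_cases i <;> simp

/-- Taylor terms of degree above `m` contribute higher powers of `E`, so after division by `E ^ m`
only the lowest form survives modulo `E`. This also shows that the division is exact. -/
theorem exists_chartMap_translate (P : Fin 2 → k) (f : MvPolynomial (Fin 2) k) (Q : Option k) :
    ∃ r, chartMap Q (translate P f) =
      excVar Q ^ mult P f * (dehomog Q (lowestForm P f) + excVar Q * r) := by
  have hlow : ∀ d < mult P f, homogeneousComponent d (translate P f) = 0 := by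
    intro d hd
    by_contra h
    exact Nat.notMem_of_lt_sInf hd h
  have hterm : ∀ d, ∃ r, chartMap Q (homogeneousComponent d (translate P f)) =
      excVar Q ^ mult P f *
        ((if d = mult P f then dehomog Q (lowestForm P f) else 0) + excVar Q * r) := by
    intro d
    rcases lt_trichotomy d (mult P f) with h | h | h
    · exact ⟨0, by rw [hlow d h]; simp [h.ne]⟩
    · refine ⟨0, ?_⟩
      rw [if_pos h, h, chartMap_of_isHomogeneous Q (homogeneousComponent_isHomogeneous _ _)]
      simp [lowestForm]
    · obtain ⟨e, rfl⟩ := Nat.exists_eq_add_of_lt h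
      refine ⟨excVar Q ^ e * dehomog Q (homogeneousComponent (mult P f + e + 1) (translate P f)),
        ?_⟩
      rw [chartMap_of_isHomogeneous Q (homogeneousComponent_isHomogeneous _ _), if_neg h.ne']
      ring
  choose r hr using hterm
  by_cases h0 : f = 0
  · subst h0
    exact ⟨0, by simp [translate, lowestForm]⟩
  have hm : mult P f ∈ Finset.range ((translate P f).totalDegree + 1) := by
    rw [Finset.mem_range, Nat.lt_succ_iff]
    by_contra! h
    exact lowestForm_ne_zero P h0 (homogeneousComponent_eq_zero _ _ h)
  refine ⟨∑ d ∈ Finset.range ((translate P f).totalDegree + 1), r d, ?_⟩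
  conv_lhs => rw [← sum_homogeneousComponent (translate P f)]
  rw [map_sum, Finset.sum_congr rfl fun d _ => hr d, ← Finset.mul_sum, Finset.sum_add_distrib,
    Finset.sum_ite_eq' _ (mult P f), if_pos hm, Finset.mul_sum]

theorem strictTransform_eq_of_chartMap {P : Fin 2 → k} {f : MvPolynomial (Fin 2) k}
    {Q : Option k} {u : MvPolynomial (Fin 2) k}
    (h : chartMap Q (translate P f) = excVar Q ^ mult P f * u) : strictTransform P f Q = u := by
  cases Q with
  | none =>
    rw [chartMap] at h
    rw [strictTransform, h, excVar, X_pow_eq_monomial]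
    exact divMonomial_monomial_mul _ _
  | some z =>
    rw [chartMap] at h
    rw [strictTransform, h, excVar, X_pow_eq_monomial]
    exact divMonomial_monomial_mul _ _

theorem chartMap_translate (P : Fin 2 → k) (f : MvPolynomial (Fin 2) k) (Q : Option k) :
    chartMap Q (translate P f) = excVar Q ^ mult P f * strictTransform P f Q := by
  obtain ⟨r, hr⟩ := exists_chartMap_translate P f Q
  rw [strictTransform_eq_of_chartMap hr, hr]

theorem exists_strictTransform_eq (P : Fin 2 → k) (f : MvPolynomial (Fin 2) k) (Q : Option k) :
    ∃ r, strictTransform P f Q = dehomog Q (lowestForm P f) + excVar Q * r := by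
  obtain ⟨r, hr⟩ := exists_chartMap_translate P f Q
  exact ⟨r, strictTransform_eq_of_chartMap hr⟩

theorem lowestForm_isHomogeneous (P : Fin 2 → k) (f : MvPolynomial (Fin 2) k) :
    (lowestForm P f).IsHomogeneous (mult P f) :=
  homogeneousComponent_isHomogeneous _ _

theorem eval_chartPoint_strictTransform (P : Fin 2 → k) (f : MvPolynomial (Fin 2) k)
    (Q : Option k) :
    eval (chartPoint Q) (strictTransform P f Q) = eval (direction Q) (lowestForm P f) := by
  obtain ⟨r, hr⟩ := exists_strictTransform_eq P f Q
  rw [hr, map_add, map_mul, eval_chartPoint_excVar, zero_mul, add_zero]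
  have : (aeval (chartPoint Q) : MvPolynomial (Fin 2) k →ₐ[k] k).comp (dehomog Q) =
      aeval (direction Q) := by
    ext i
    cases Q <;> fin_cases i <;> simp [chartPoint, dehomog, direction]
  exact DFunLike.congr_fun this _

theorem mem_commonNearPoints_iff {P : Fin 2 → k} {f g : MvPolynomial (Fin 2) k} {Q : Option k} :
    Q ∈ commonNearPoints P f g ↔
      eval (direction Q) (lowestForm P f) = 0 ∧ eval (direction Q) (lowestForm P g) = 0 := by
  rw [← eval_chartPoint_strictTransform, ← eval_chartPoint_strictTransform]
  rfl

/-! ### Binary forms -/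

theorem coeff_aeval_one_X {F : MvPolynomial (Fin 2) k} {d : ℕ} (hF : F.IsHomogeneous d) (j : ℕ) :
    (aeval ![1, Polynomial.X] F : Polynomial k).coeff j =
      if j ≤ d then coeff (Finsupp.single 0 (d - j) + Finsupp.single 1 j) F else 0 := by
  have hd : ∀ s ∈ F.support, s 0 + s 1 = d := fun s hs =>
    add_eq_of_coeff_ne_zero hF (mem_support_iff.1 hs)
  rw [aeval_def, eval₂_eq', Polynomial.finsetSum_coeff]
  have h1 : ∀ s ∈ F.support, (algebraMap k (Polynomial k) (coeff s F) *
      ∏ i, (![1, Polynomial.X] : Fin 2 → Polynomial k) i ^ s i).coeff j =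
      if s 1 = j then coeff s F else 0 := by
    intro s hs
    simp [Fin.prod_univ_two, Polynomial.coeff_X_pow, Polynomial.algebraMap_eq, eq_comm]
  rw [Finset.sum_congr rfl h1]
  split_ifs with hj
  · rw [Finset.sum_eq_single (Finsupp.single 0 (d - j) + Finsupp.single 1 j)]
    · simp
    · intro s hs hne
      rw [if_neg]
      intro hsj
      apply hne
      have := hd s hs
      ext i
      fin_cases i
      · simp
        omega
      · simpa using hsj
    · intro h
      rw [notMem_support_iff.1 h, ite_self]
  · refine Finset.sum_eq_zero fun s hs => if_neg ?_
    have := hd s hs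
    omega

theorem coeff_aeval_X_one {F : MvPolynomial (Fin 2) k} {d : ℕ} (hF : F.IsHomogeneous d) (j : ℕ) :
    (aeval ![Polynomial.X, 1] F : Polynomial k).coeff j =
      if j ≤ d then coeff (Finsupp.single 0 j + Finsupp.single 1 (d - j)) F else 0 := by
  have hd : ∀ s ∈ F.support, s 0 + s 1 = d := fun s hs =>
    add_eq_of_coeff_ne_zero hF (mem_support_iff.1 hs)
  rw [aeval_def, eval₂_eq', Polynomial.finsetSum_coeff]
  have h1 : ∀ s ∈ F.support, (algebraMap k (Polynomial k) (coeff s F) *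
      ∏ i, (![Polynomial.X, 1] : Fin 2 → Polynomial k) i ^ s i).coeff j =
      if s 0 = j then coeff s F else 0 := by
    intro s hs
    simp [Fin.prod_univ_two, Polynomial.coeff_X_pow, Polynomial.algebraMap_eq, eq_comm]
  rw [Finset.sum_congr rfl h1]
  split_ifs with hj
  · rw [Finset.sum_eq_single (Finsupp.single 0 j + Finsupp.single 1 (d - j))]
    · simp
    · intro s hs hne
      rw [if_neg]
      intro hsj
      apply hne
      have := hd s hs
      ext i
      fin_cases i
      · simpa using hsj
      · simp
        omega
    · intro h
      rw [notMem_support_iff.1 h, ite_self]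
  · refine Finset.sum_eq_zero fun s hs => if_neg ?_
    have := hd s hs
    omega

/-- The two dehomogenizations of a binary form have reversed coefficients, so the order of its zero
at `(0 : 1)` is the drop in degree of the other dehomogenization. -/
theorem aeval_X_one_eq_reflect {F : MvPolynomial (Fin 2) k} {d : ℕ} (hF : F.IsHomogeneous d) :
    (aeval ![Polynomial.X, 1] F : Polynomial k) =
      Polynomial.reflect d (aeval ![1, Polynomial.X] F) := by
  ext j
  rw [Polynomial.coeff_reflect, coeff_aeval_X_one hF, coeff_aeval_one_X hF]
  by_cases hj : j ≤ d
  · rw [Polynomial.revAt_le hj, if_pos hj, if_pos (Nat.sub_le _ _), Nat.sub_sub_self hj]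
  · rw [Polynomial.revAt_eq_self_of_lt (not_le.1 hj), if_neg hj, if_neg hj]

theorem aeval_one_X_ne_zero {F : MvPolynomial (Fin 2) k} {d : ℕ} (hF : F.IsHomogeneous d)
    (h0 : F ≠ 0) : (aeval ![1, Polynomial.X] F : Polynomial k) ≠ 0 := by
  intro h
  obtain ⟨s, hs⟩ := ne_zero_iff.1 h0
  have hd := add_eq_of_coeff_ne_zero hF hs
  have h1 := coeff_aeval_one_X hF (s 1)
  rw [h, Polynomial.coeff_zero, if_pos (by omega)] at h1
  apply hs
  rw [h1]
  congr 1
  ext i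
  fin_cases i
  · simp
    omega
  · simp

theorem natDegree_aeval_one_X_le {F : MvPolynomial (Fin 2) k} {d : ℕ} (hF : F.IsHomogeneous d) :
    (aeval ![1, Polynomial.X] F : Polynomial k).natDegree ≤ d := by
  rw [Polynomial.natDegree_le_iff_coeff_eq_zero]
  intro j hj
  rw [coeff_aeval_one_X hF, if_neg (not_le.2 hj)]

theorem natTrailingDegree_reflect {p : Polynomial k} (hp : p ≠ 0) {d : ℕ}
    (hd : p.natDegree ≤ d) :
    (Polynomial.reflect d p).natTrailingDegree = d - p.natDegree := by
  have hc : (Polynomial.reflect d p).coeff (d - p.natDegree) ≠ 0 := by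
    rw [Polynomial.coeff_reflect, Polynomial.revAt_le (Nat.sub_le _ _), Nat.sub_sub_self hd]
    exact Polynomial.leadingCoeff_ne_zero.2 hp
  refine le_antisymm (Polynomial.natTrailingDegree_le_of_ne_zero hc) ?_
  refine Polynomial.le_natTrailingDegree (fun h => hc (by rw [h, Polynomial.coeff_zero]))
    fun j hj => ?_
  rw [Polynomial.coeff_reflect, Polynomial.revAt_le (by omega)]
  exact Polynomial.coeff_eq_zero_of_natDegree_lt (by omega)

theorem excRestrict_strictTransform (P : Fin 2 → k) (f : MvPolynomial (Fin 2) k)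
    (Q : Option k) :
    excRestrict Q (strictTransform P f Q) = excRestrict Q (dehomog Q (lowestForm P f)) := by
  obtain ⟨r, hr⟩ := exists_strictTransform_eq P f Q
  rw [hr, map_add, map_mul, excRestrict_excVar, zero_mul, add_zero]

theorem excRestrict_strictTransform_some (P : Fin 2 → k) (f : MvPolynomial (Fin 2) k) (z : k) :
    excRestrict (some z) (strictTransform P f (some z)) =
      aeval ![1, Polynomial.X] (lowestForm P f) := by
  rw [excRestrict_strictTransform]
  have : (excRestrict (some z)).comp (dehomog (some z)) = aeval ![1, Polynomial.X] := by
    ext i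
    fin_cases i <;> simp [excRestrict, dehomog]
  exact DFunLike.congr_fun this _

theorem excRestrict_strictTransform_none (P : Fin 2 → k) (f : MvPolynomial (Fin 2) k) :
    excRestrict none (strictTransform P f none) = aeval ![Polynomial.X, 1] (lowestForm P f) := by
  rw [excRestrict_strictTransform]
  have : (excRestrict none).comp (dehomog (none : Option k)) = aeval ![Polynomial.X, 1] := by
    ext i
    fin_cases i <;> simp [excRestrict, dehomog]
  exact DFunLike.congr_fun this _

theorem excRestrict_strictTransform_ne_zero (P : Fin 2 → k) {f : MvPolynomial (Fin 2) k}
    (hf : f ≠ 0) (Q : Option k) : excRestrict Q (strictTransform P f Q) ≠ 0 := by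
  have h1 := aeval_one_X_ne_zero (lowestForm_isHomogeneous P f) (lowestForm_ne_zero P hf)
  cases Q with
  | none =>
    rw [excRestrict_strictTransform_none, aeval_X_one_eq_reflect (lowestForm_isHomogeneous P f)]
    rwa [Ne, Polynomial.reflect_eq_zero_iff]
  | some z => rwa [excRestrict_strictTransform_some]

theorem strictTransform_ne_zero (P : Fin 2 → k) {f : MvPolynomial (Fin 2) k}
    (hf : f ≠ 0) (Q : Option k) : strictTransform P f Q ≠ 0 := fun h =>
  excRestrict_strictTransform_ne_zero P hf Q (by rw [h, map_zero])

/-! ### Multiplicities -/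

/-- A polynomial with nonzero restriction to the exceptional line is not divisible by `E`. This
reads the multiplicity off a pull-back as its exact power of `E`. -/
theorem pow_excVar_inj {Q : Option k} {u v : MvPolynomial (Fin 2) k} {a b : ℕ}
    (hu : excRestrict Q u ≠ 0) (hv : excRestrict Q v ≠ 0)
    (h : excVar Q ^ a * u = excVar Q ^ b * v) : a = b := by
  have key : ∀ {u v : MvPolynomial (Fin 2) k} {a b : ℕ}, excRestrict Q u ≠ 0 →
      excVar Q ^ a * u = excVar Q ^ b * v → b ≤ a := by
    intro u v a b hu h
    by_contra! hab
    obtain ⟨c, rfl⟩ := Nat.exists_eq_add_of_lt hab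
    have h1 : u = excVar Q * (excVar Q ^ c * v) := by
      apply mul_left_cancel₀ (pow_ne_zero a (excVar_ne_zero Q))
      rw [h]
      ring
    apply hu
    rw [h1, map_mul, excRestrict_excVar, zero_mul]
  exact le_antisymm (key hv h.symm) (key hu h)

theorem mult_mul (P : Fin 2 → k) {f g : MvPolynomial (Fin 2) k} (hf : f ≠ 0) (hg : g ≠ 0) :
    mult P (f * g) = mult P f + mult P g := by
  refine pow_excVar_inj (Q := none) (u := strictTransform P (f * g) none)
    (v := strictTransform P f none * strictTransform P g none)
    (excRestrict_strictTransform_ne_zero P (mul_ne_zero hf hg) _) ?_ ?_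
  · rw [map_mul]
    exact mul_ne_zero (excRestrict_strictTransform_ne_zero P hf _)
      (excRestrict_strictTransform_ne_zero P hg _)
  · rw [← chartMap_translate, translate_mul, map_mul, chartMap_translate, chartMap_translate]
    ring

theorem strictTransform_mul (P : Fin 2 → k) {f g : MvPolynomial (Fin 2) k} (hf : f ≠ 0)
    (hg : g ≠ 0) (Q : Option k) :
    strictTransform P (f * g) Q = strictTransform P f Q * strictTransform P g Q := by
  apply strictTransform_eq_of_chartMap
  rw [translate_mul, map_mul, chartMap_translate, chartMap_translate, mult_mul P hf hg]
  ring

theorem le_mult_of_forall {P : Fin 2 → k} {f : MvPolynomial (Fin 2) k} (hf : f ≠ 0) {n : ℕ}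
    (h : ∀ d < n, homogeneousComponent d (translate P f) = 0) : n ≤ mult P f := by
  by_contra! hlt
  exact lowestForm_ne_zero P hf (h _ hlt)

theorem homogeneousComponent_translate_of_lt {P : Fin 2 → k} {f : MvPolynomial (Fin 2) k} {d : ℕ}
    (h : d < mult P f) : homogeneousComponent d (translate P f) = 0 := by
  by_contra hd
  exact Nat.notMem_of_lt_sInf h hd

theorem mult_eq_of_isHomogeneous {P : Fin 2 → k} {f : MvPolynomial (Fin 2) k} {d : ℕ} (hf : f ≠ 0)
    (h : (translate P f).IsHomogeneous d) : mult P f = d := by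
  by_contra hne
  apply lowestForm_ne_zero P hf
  rw [lowestForm, homogeneousComponent_of_mem h, if_neg hne]

theorem lowestForm_eq_of_isHomogeneous {P : Fin 2 → k} {f : MvPolynomial (Fin 2) k} {d : ℕ}
    (hf : f ≠ 0) (h : (translate P f).IsHomogeneous d) : lowestForm P f = translate P f := by
  rw [lowestForm, mult_eq_of_isHomogeneous hf h, homogeneousComponent_of_mem h, if_pos rfl]

theorem mult_eq_zero_iff {P : Fin 2 → k} {f : MvPolynomial (Fin 2) k} (hf : f ≠ 0) :
    mult P f = 0 ↔ eval P f ≠ 0 := by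
  have h0 : homogeneousComponent 0 (translate P f) = C (eval P f) := by
    rw [homogeneousComponent_zero, ← constantCoeff_eq, ← eval_zero, eval_translate, zero_add]
  constructor
  · intro h
    have := lowestForm_ne_zero P hf
    rw [lowestForm, h, h0] at this
    simpa using this
  · intro h
    by_contra hm
    have := homogeneousComponent_translate_of_lt (Nat.pos_of_ne_zero hm)
    rw [h0] at this
    exact h (by simpa using this)

theorem eval_direction_lowestForm_ne_zero {P : Fin 2 → k} {f : MvPolynomial (Fin 2) k}
    (h : eval P f ≠ 0) (Q : Option k) : eval (direction Q) (lowestForm P f) ≠ 0 := by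
  have hf : f ≠ 0 := by
    rintro rfl
    simp at h
  rw [lowestForm, (mult_eq_zero_iff hf).2 h, homogeneousComponent_zero, ← constantCoeff_eq,
    ← eval_zero, eval_translate, zero_add, eval_C]
  exact h

/-! ### Common components -/

theorem ShareComponent.symm {P : Fin 2 → k} {f g : MvPolynomial (Fin 2) k}
    (h : ShareComponent P f g) : ShareComponent P g f := by
  obtain ⟨d, hd, hf, hg, h0⟩ := h
  exact ⟨d, hd, hg, hf, h0⟩

theorem shareComponent_comm {P : Fin 2 → k} {f g : MvPolynomial (Fin 2) k} :
    ShareComponent P f g ↔ ShareComponent P g f :=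
  ⟨ShareComponent.symm, ShareComponent.symm⟩

theorem ShareComponent.eval_left {P : Fin 2 → k} {f g : MvPolynomial (Fin 2) k}
    (h : ShareComponent P f g) : eval P f = 0 := by
  obtain ⟨d, -, ⟨f, rfl⟩, -, h0⟩ := h
  rw [map_mul, h0, zero_mul]

theorem ShareComponent.eval_right {P : Fin 2 → k} {f g : MvPolynomial (Fin 2) k}
    (h : ShareComponent P f g) : eval P g = 0 := h.symm.eval_left

theorem shareComponent_of_dvd {P : Fin 2 → k} {d f g : MvPolynomial (Fin 2) k} (hf : d ∣ f)
    (hg : d ∣ g) (hd : eval P d = 0) : ShareComponent P f g := by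
  -- Pairing `d` with the zero polynomial yields an irreducible factor of `d` through `P`, even for
  -- `d = 0`.
  obtain ⟨c, hc, -, hcd, h0⟩ := shareComponent_zero_left hd
  exact ⟨c, hc, hcd.trans hf, hcd.trans hg, h0⟩

theorem shareComponent_mul_left_iff {P : Fin 2 → k} {f₁ f₂ g : MvPolynomial (Fin 2) k} :
    ShareComponent P (f₁ * f₂) g ↔ ShareComponent P f₁ g ∨ ShareComponent P f₂ g := by
  constructor
  · rintro ⟨d, hd, hf, hg, h0⟩
    rcases hd.prime.dvd_or_dvd hf with h | h
    · exact Or.inl ⟨d, hd, h, hg, h0⟩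
    · exact Or.inr ⟨d, hd, h, hg, h0⟩
  · rintro (⟨d, hd, hf, hg, h0⟩ | ⟨d, hd, hf, hg, h0⟩)
    · exact ⟨d, hd, hf.mul_right _, hg, h0⟩
    · exact ⟨d, hd, hf.mul_left _, hg, h0⟩

theorem shareComponent_add_mul_iff {P : Fin 2 → k} {f g h : MvPolynomial (Fin 2) k} :
    ShareComponent P f (g + h * f) ↔ ShareComponent P f g := by
  constructor
  · rintro ⟨d, hd, hf, hg, h0⟩
    exact ⟨d, hd, hf, (dvd_add_left (hf.mul_left h)).1 hg, h0⟩
  · rintro ⟨d, hd, hf, hg, h0⟩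
    exact ⟨d, hd, hf, (dvd_add_left (hf.mul_left h)).2 hg, h0⟩

theorem ne_zero_of_not_shareComponent {P : Fin 2 → k} {f g : MvPolynomial (Fin 2) k}
    (h : ¬ ShareComponent P f g) (hg : eval P g = 0) : f ≠ 0 := by
  rintro rfl
  exact h (shareComponent_zero_left hg)

/-! ### The recursion for the blowup number -/

theorem blowupApprox_eq_zero (n : ℕ) {P : Fin 2 → k} {f g : MvPolynomial (Fin 2) k}
    (h : ¬ (eval P f = 0 ∧ eval P g = 0)) : blowupApprox n P f g = 0 := by
  cases n with
  | zero => rfl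
  | succ n =>
    rw [blowupApprox, blowupStep, if_neg fun hs => h ⟨hs.eval_left, hs.eval_right⟩, if_pos h]

theorem blowupNumber_eq_zero {P : Fin 2 → k} {f g : MvPolynomial (Fin 2) k}
    (h : ¬ (eval P f = 0 ∧ eval P g = 0)) : blowupNumber P f g = 0 := by
  rw [blowupNumber_eq, blowupStep, if_neg fun hs => h ⟨hs.eval_left, hs.eval_right⟩, if_pos h]

theorem blowupNumber_eq_top {P : Fin 2 → k} {f g : MvPolynomial (Fin 2) k}
    (h : ShareComponent P f g) : blowupNumber P f g = ⊤ := by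
  rw [blowupNumber_eq, blowupStep, if_pos h]

theorem finite_support_nearPoints
    {B : (Fin 2 → k) → MvPolynomial (Fin 2) k → MvPolynomial (Fin 2) k → ℕ∞}
    (hB : ∀ P f g, ¬ (eval P f = 0 ∧ eval P g = 0) → B P f g = 0) (P : Fin 2 → k)
    {f : MvPolynomial (Fin 2) k} (hf : f ≠ 0) (v : Option k → MvPolynomial (Fin 2) k) :
    (Function.support fun Q => B (chartPoint Q) (strictTransform P f Q) (v Q)).Finite := by
  refine (commonNearPoints_finite P hf f).subset fun Q hQ => ?_
  by_contra h
  refine hQ (hB _ _ _ fun h' => h ⟨h'.1, h'.1⟩)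

/-- If `P` misses one of the curves, that curve has multiplicity 0 and a nonzero constant as lowest
form, so the right side is 0 anyway. With the case distinction gone and the sum over all of `ℙ¹`,
sums for different curves can be added and compared. -/
theorem blowupStep_of_not_shareComponent
    {B : (Fin 2 → k) → MvPolynomial (Fin 2) k → MvPolynomial (Fin 2) k → ℕ∞}
    (hB : ∀ P f g, ¬ (eval P f = 0 ∧ eval P g = 0) → B P f g = 0) {P : Fin 2 → k}
    {f g : MvPolynomial (Fin 2) k} (h : ¬ ShareComponent P f g) (hf : f ≠ 0) (hg : g ≠ 0) :
    blowupStep B P f g = ((mult P f * mult P g : ℕ) : ℕ∞) +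
      ∑ᶠ Q, B (chartPoint Q) (strictTransform P f Q) (strictTransform P g Q) := by
  have hsum : ∑ᶠ Q ∈ commonNearPoints P f g,
      B (chartPoint Q) (strictTransform P f Q) (strictTransform P g Q) =
      ∑ᶠ Q, B (chartPoint Q) (strictTransform P f Q) (strictTransform P g Q) := by
    refine finsum_congr fun Q => ?_
    by_cases hQ : Q ∈ commonNearPoints P f g
    · simp [hQ]
    · rw [hB _ _ _ hQ]
      simp
  rw [blowupStep, if_neg h]
  split_ifs with h0
  · rw [hsum]
  · have hm : mult P f * mult P g = 0 := by
      rw [mul_eq_zero, mult_eq_zero_iff hf, mult_eq_zero_iff hg]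
      tauto
    rw [hm, finsum_eq_zero_of_forall_eq_zero, Nat.cast_zero, add_zero]
    intro Q
    apply hB
    rw [eval_chartPoint_strictTransform, eval_chartPoint_strictTransform]
    rintro ⟨h1, h2⟩
    refine h0 ⟨?_, ?_⟩
    · by_contra hc
      exact eval_direction_lowestForm_ne_zero hc Q h1
    · by_contra hc
      exact eval_direction_lowestForm_ne_zero hc Q h2

theorem blowupNumber_eq_add_finsum {P : Fin 2 → k} {f g : MvPolynomial (Fin 2) k}
    (h : ¬ ShareComponent P f g) (hf : f ≠ 0) (hg : g ≠ 0) :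
    blowupNumber P f g = ((mult P f * mult P g : ℕ) : ℕ∞) +
      ∑ᶠ Q, blowupNumber (chartPoint Q) (strictTransform P f Q) (strictTransform P g Q) := by
  rw [blowupNumber_eq, blowupStep_of_not_shareComponent (fun _ _ _ => blowupNumber_eq_zero) h hf hg]

theorem blowupApprox_comm (n : ℕ) (P : Fin 2 → k) (f g : MvPolynomial (Fin 2) k) :
    blowupApprox n P f g = blowupApprox n P g f := by
  induction n generalizing P f g with
  | zero => rfl
  | succ n ih =>
    have hc : commonNearPoints P f g = commonNearPoints P g f := by
      ext Q
      exact and_comm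
    rw [blowupApprox, blowupStep, blowupStep, hc, mul_comm (mult P f),
      finsum_congr fun Q => finsum_congr fun _ => ih _ (strictTransform P f Q) _]
    by_cases hs : ShareComponent P f g
    · rw [if_pos hs, if_pos hs.symm]
    · rw [if_neg hs, if_neg fun h : ShareComponent P g f => hs h.symm]
      by_cases h0 : eval P f = 0 ∧ eval P g = 0
      · rw [if_neg (not_not.2 h0), if_neg (not_not.2 h0.symm)]
      · rw [if_pos h0, if_pos fun h => h0 h.symm]

theorem blowupNumber_comm (P : Fin 2 → k) (f g : MvPolynomial (Fin 2) k) :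
    blowupNumber P f g = blowupNumber P g f :=
  iSup_congr fun n => blowupApprox_comm n P f g

/-- Additivity already holds at each cut-off depth, where induction is available; it passes to the
limit because the approximations increase. -/
theorem blowupApprox_mul (n : ℕ) (P : Fin 2 → k) {f₁ f₂ g : MvPolynomial (Fin 2) k}
    (h₁ : f₁ ≠ 0) (h₂ : f₂ ≠ 0) (hg : g ≠ 0) :
    blowupApprox n P (f₁ * f₂) g = blowupApprox n P f₁ g + blowupApprox n P f₂ g := by
  induction n generalizing P f₁ f₂ g with
  | zero => simp [blowupApprox]
  | succ n ih =>
    by_cases hs : ShareComponent P (f₁ * f₂) g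
    · rw [blowupApprox, blowupStep, if_pos hs]
      rcases shareComponent_mul_left_iff.1 hs with h | h
      · rw [blowupStep, if_pos h, top_add]
      · rw [add_comm, blowupStep, if_pos h, top_add]
    · have hs' := hs
      rw [shareComponent_mul_left_iff, not_or] at hs'
      have hB := fun P f g => blowupApprox_eq_zero (k := k) n (P := P) (f := f) (g := g)
      rw [blowupApprox, blowupStep_of_not_shareComponent hB hs (mul_ne_zero h₁ h₂) hg,
        blowupStep_of_not_shareComponent hB hs'.1 h₁ hg,
        blowupStep_of_not_shareComponent hB hs'.2 h₂ hg, mult_mul P h₁ h₂,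
        finsum_congr fun Q => by
          rw [strictTransform_mul P h₁ h₂, ih _ (strictTransform_ne_zero P h₁ Q)
            (strictTransform_ne_zero P h₂ Q) (strictTransform_ne_zero P hg Q)],
        finsum_add_distrib (finite_support_nearPoints hB P h₁ _)
          (finite_support_nearPoints hB P h₂ _)]
      push_cast
      ring

theorem blowupNumber_mul_left (P : Fin 2 → k) {f₁ f₂ g : MvPolynomial (Fin 2) k}
    (h₁ : f₁ ≠ 0) (h₂ : f₂ ≠ 0) (hg : g ≠ 0) :
    blowupNumber P (f₁ * f₂) g = blowupNumber P f₁ g + blowupNumber P f₂ g := by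
  have hlim : ∀ P f g, Filter.Tendsto (fun n => blowupApprox n P f g) Filter.atTop
      (nhds (blowupNumber (k := k) P f g)) := fun P f g =>
    tendsto_atTop_iSup (blowupApprox_mono P f g)
  refine tendsto_nhds_unique (hlim P (f₁ * f₂) g) ?_
  simp only [blowupApprox_mul _ P h₁ h₂ hg]
  exact (hlim P f₁ g).add (hlim P f₂ g)

theorem blowupNumber_mul_right (P : Fin 2 → k) {f g₁ g₂ : MvPolynomial (Fin 2) k}
    (hf : f ≠ 0) (h₁ : g₁ ≠ 0) (h₂ : g₂ ≠ 0) :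
    blowupNumber P f (g₁ * g₂) = blowupNumber P f g₁ + blowupNumber P f g₂ := by
  rw [blowupNumber_comm, blowupNumber_mul_left P h₁ h₂ hf, blowupNumber_comm P g₁,
    blowupNumber_comm P g₂]

theorem blowupNumber_pow_mul_right (P : Fin 2 → k) {f u g : MvPolynomial (Fin 2) k}
    (hf : f ≠ 0) (hu : u ≠ 0) (hg : g ≠ 0) (e : ℕ) :
    blowupNumber P f (u ^ e * g) = e * blowupNumber P f u + blowupNumber P f g := by
  induction e with
  | zero => simp
  | succ e ih =>
    rw [pow_succ', mul_assoc, blowupNumber_mul_right P hf hu (mul_ne_zero (pow_ne_zero e hu) hg),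
      ih]
    push_cast
    ring

/-! ### Intersections with coordinate lines -/

/-- Restriction to the coordinate line `X i = P i`. -/
def lineRestrict (i : Fin 2) (P : Fin 2 → k) : MvPolynomial (Fin 2) k →ₐ[k] Polynomial k :=
  aeval fun j => if j = i then Polynomial.C (P i) else Polynomial.X

/-- The direction of the coordinate lines on which `X i` is constant. -/
def lineNearPoint : Fin 2 → Option k := ![none, some 0]

theorem chartPoint_lineNearPoint (i : Fin 2) : chartPoint (lineNearPoint i : Option k) = 0 := by
  funext j
  fin_cases i <;> fin_cases j <;> simp [lineNearPoint, chartPoint]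

theorem X_sub_C_ne_zero (i : Fin 2) (c : k) : (X i - C c : MvPolynomial (Fin 2) k) ≠ 0 := by
  intro h
  have := congrArg (eval fun _ => c + 1) h
  simp at this

theorem translate_X_sub_C (P : Fin 2 → k) (i : Fin 2) :
    translate P (X i - C (P i)) = X i := by
  rw [translate, map_sub, aeval_X, ← algebraMap_eq, AlgHom.commutes]
  simp

theorem mult_X_sub_C (P : Fin 2 → k) (i : Fin 2) : mult P (X i - C (P i)) = 1 :=
  mult_eq_of_isHomogeneous (X_sub_C_ne_zero _ _)
    ((translate_X_sub_C P i).symm ▸ isHomogeneous_X _ _)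

theorem lowestForm_X_sub_C (P : Fin 2 → k) (i : Fin 2) : lowestForm P (X i - C (P i)) = X i := by
  rw [lowestForm_eq_of_isHomogeneous (X_sub_C_ne_zero _ _)
    ((translate_X_sub_C P i).symm ▸ isHomogeneous_X _ _), translate_X_sub_C]

theorem strictTransform_X_sub_C (P : Fin 2 → k) (i : Fin 2) :
    strictTransform P (X i - C (P i)) (lineNearPoint i) = X i := by
  apply strictTransform_eq_of_chartMap
  rw [mult_X_sub_C, translate_X_sub_C, pow_one]
  fin_cases i <;> simp [lineNearPoint, chartMap, excVar, mul_comm]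

theorem eval_direction_X_ne_zero {i : Fin 2} {Q : Option k} (h : Q ≠ lineNearPoint i) :
    eval (direction Q) (X i) ≠ 0 := by
  cases Q <;> fin_cases i <;> simp_all [lineNearPoint, direction]

theorem lineRestrict_zero_excVar (i : Fin 2) :
    lineRestrict i (0 : Fin 2 → k) (excVar (lineNearPoint i)) = Polynomial.X := by
  fin_cases i <;> simp [lineRestrict, lineNearPoint, excVar]

/-- Blowing up does not change the line itself: restricting to its strict transform is restricting
to the line, with the parameter shifted. Here `i.rev` is the other coordinate. -/
theorem lineRestrict_chartMap_translate (i : Fin 2) (P : Fin 2 → k)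
    (f : MvPolynomial (Fin 2) k) :
    lineRestrict i 0 (chartMap (lineNearPoint i) (translate P f)) =
      (lineRestrict i P f).comp (Polynomial.X + Polynomial.C (P i.rev)) := by
  have : ((lineRestrict i (0 : Fin 2 → k)).comp (chartMap (lineNearPoint i))).comp
      (aeval fun i => X i + C (P i)) =
      (Polynomial.aeval (Polynomial.X + Polynomial.C (P i.rev))).comp (lineRestrict i P) := by
    have hC : ∀ (φ : MvPolynomial (Fin 2) k →ₐ[k] Polynomial k) (c : k),
        φ (C c) = Polynomial.C c := fun φ c => by
      rw [← algebraMap_eq, AlgHom.commutes, Polynomial.algebraMap_eq]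
    apply MvPolynomial.algHom_ext
    intro j
    simp only [AlgHom.comp_apply, aeval_X, map_add, hC]
    fin_cases i <;> fin_cases j <;>
      simp [lineRestrict, lineNearPoint, chartMap]
  exact DFunLike.congr_fun this f

theorem eval_lineRestrict (i : Fin 2) (P : Fin 2 → k) (f : MvPolynomial (Fin 2) k) :
    (lineRestrict i P f).eval (P i.rev) = eval P f := by
  have : (Polynomial.aeval (P i.rev)).comp (lineRestrict i P) = aeval P := by
    apply MvPolynomial.algHom_ext
    intro j
    fin_cases i <;> fin_cases j <;> simp [lineRestrict]
  exact DFunLike.congr_fun this f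

theorem lineRestrict_X_sub_C (i : Fin 2) (P : Fin 2 → k) :
    lineRestrict i P (X i - C (P i)) = 0 := by
  rw [map_sub, ← algebraMap_eq, AlgHom.commutes]
  simp [lineRestrict]

theorem totalDegree_X_sub_C (i : Fin 2) (c : k) :
    (X i - C c : MvPolynomial (Fin 2) k).totalDegree = 1 := by
  rw [sub_eq_add_neg, ← C_neg, totalDegree_add_eq_left_of_totalDegree_lt] <;> simp

theorem X_sub_C_irreducible (i : Fin 2) (c : k) :
    Irreducible (X i - C c : MvPolynomial (Fin 2) k) := by
  refine irreducible_of_totalDegree_eq_one (totalDegree_X_sub_C i c) fun x hx => ?_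
  have h1 := hx (Finsupp.single i 1)
  rw [coeff_sub, coeff_X, coeff_C, if_pos rfl,
    if_neg (Finsupp.single_ne_zero.2 one_ne_zero).symm, sub_zero] at h1
  exact isUnit_of_dvd_one h1

theorem not_shareComponent_X_sub_C {i : Fin 2} {P : Fin 2 → k} {f : MvPolynomial (Fin 2) k}
    (h : lineRestrict i P f ≠ 0) : ¬ ShareComponent P (X i - C (P i)) f := by
  rintro ⟨d, hd, h1, h2, -⟩
  have hdvd : X i - C (P i) ∣ f :=
    ((hd.associated_of_dvd (X_sub_C_irreducible i _) h1).symm.dvd).trans h2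
  obtain ⟨q, rfl⟩ := hdvd
  rw [map_mul, lineRestrict_X_sub_C, zero_mul] at h
  exact h rfl

/-- The strict transform of the line is again a coordinate line, through a single near point, and
each blowup lowers the order of vanishing of `f` along it by `m_P(f)`. -/
theorem blowupNumber_X_sub_C (i : Fin 2) (P : Fin 2 → k) {f : MvPolynomial (Fin 2) k}
    (h : lineRestrict i P f ≠ 0) :
    blowupNumber P (X i - C (P i)) f = (lineRestrict i P f).rootMultiplicity (P i.rev) := by
  induction hN : (lineRestrict i P f).rootMultiplicity (P i.rev) using Nat.strong_induction_on
    generalizing P f with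
  | _ N ih =>
  have hf : f ≠ 0 := by
    rintro rfl
    simp at h
  by_cases h0 : eval P f = 0
  swap
  · rw [blowupNumber_eq_zero fun h' => h0 h'.2, ← hN, Polynomial.rootMultiplicity_eq_zero,
      Nat.cast_zero]
    rwa [Polynomial.IsRoot.def, eval_lineRestrict]
  have hm : 0 < mult P f := Nat.pos_of_ne_zero fun h' => (mult_eq_zero_iff hf).1 h' h0
  rw [blowupNumber_eq_add_finsum (not_shareComponent_X_sub_C h) (X_sub_C_ne_zero _ _) hf,
    finsum_eq_single _ (lineNearPoint i), strictTransform_X_sub_C, mult_X_sub_C, one_mul]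
  swap
  · intro Q hQ
    apply blowupNumber_eq_zero
    rintro ⟨h1, -⟩
    rw [eval_chartPoint_strictTransform, lowestForm_X_sub_C] at h1
    exact eval_direction_X_ne_zero hQ h1
  have hr := lineRestrict_chartMap_translate i P f
  rw [chartMap_translate, map_mul, map_pow, lineRestrict_zero_excVar] at hr
  set q := lineRestrict i 0 (strictTransform P f (lineNearPoint i)) with hq
  have hc : (lineRestrict i P f).comp (Polynomial.X + Polynomial.C (P i.rev)) ≠ 0 := by
    rwa [Ne, Polynomial.comp_X_add_C_eq_zero_iff]
  have hq0 : q ≠ 0 := by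
    rintro h'
    rw [h', mul_zero] at hr
    exact hc hr.symm
  have hmul : mult P f + q.rootMultiplicity 0 = N := by
    rw [← hN, Polynomial.rootMultiplicity_eq_rootMultiplicity (t := P i.rev), ← hr,
      Polynomial.rootMultiplicity_mul (hr ▸ hc)]
    congr 1
    have := Polynomial.rootMultiplicity_X_sub_C_pow (0 : k) (mult P f)
    rw [Polynomial.C_0, sub_zero] at this
    exact this.symm
  have := ih (q.rootMultiplicity 0) (by omega) 0 (f := strictTransform P f (lineNearPoint i)) hq0
    rfl
  rw [Pi.zero_apply, C_0, sub_zero] at this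
  rw [chartPoint_lineNearPoint, this, ← hmul]
  push_cast
  rfl

theorem blowupNumber_excVar_right_some (z : k) {f : MvPolynomial (Fin 2) k}
    (h : excRestrict (some z) f ≠ 0) :
    blowupNumber (chartPoint (some z)) f (excVar (some z)) =
      (excRestrict (some z) f).rootMultiplicity z := by
  have hr : excRestrict (some z) = lineRestrict 0 (chartPoint (some z)) := by
    ext j
    fin_cases j <;> simp [excRestrict, lineRestrict, chartPoint]
  rw [hr] at h ⊢
  have := blowupNumber_X_sub_C 0 _ h
  rw [blowupNumber_comm]
  simpa [chartPoint, excVar] using this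

theorem blowupNumber_excVar_right_none {f : MvPolynomial (Fin 2) k}
    (h : excRestrict none f ≠ 0) :
    blowupNumber (chartPoint none) f (excVar none) = (excRestrict none f).rootMultiplicity 0 := by
  have hr : excRestrict none = lineRestrict 1 (chartPoint (none : Option k)) := by
    ext j
    fin_cases j <;> simp [excRestrict, lineRestrict, chartPoint]
  rw [hr] at h ⊢
  have := blowupNumber_X_sub_C 1 _ h
  rw [blowupNumber_comm]
  simpa [chartPoint, excVar] using this

/-- The strict transform meets the exceptional line in `m_P(f)` points, counted with
multiplicities. -/
theorem finsum_blowupNumber_excVar [IsAlgClosed k] (P : Fin 2 → k) {f : MvPolynomial (Fin 2) k}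
    (hf : f ≠ 0) :
    ∑ᶠ Q, blowupNumber (chartPoint Q) (strictTransform P f Q) (excVar Q) = mult P f := by
  set F := lowestForm P f with hF
  have hFh := lowestForm_isHomogeneous P f
  have hF0 := lowestForm_ne_zero P hf
  set p : Polynomial k := aeval ![1, Polynomial.X] F with hp
  have hp0 : p ≠ 0 := aeval_one_X_ne_zero hFh hF0
  have hsome : ∀ z, blowupNumber (chartPoint (some z)) (strictTransform P f (some z))
      (excVar (some z)) = p.rootMultiplicity z := fun z => by
    rw [blowupNumber_excVar_right_some z (excRestrict_strictTransform_ne_zero P hf _),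
      excRestrict_strictTransform_some]
  -- The point `(0 : 1)` accounts for the roots that `p` lacks for having degree below `m_P(f)`.
  have hnone : blowupNumber (chartPoint none) (strictTransform P f none)
      (excVar none) = (mult P f - p.natDegree : ℕ) := by
    rw [blowupNumber_excVar_right_none (excRestrict_strictTransform_ne_zero P hf _),
      excRestrict_strictTransform_none, aeval_X_one_eq_reflect hFh,
      Polynomial.rootMultiplicity_eq_natTrailingDegree',
      natTrailingDegree_reflect hp0 (natDegree_aeval_one_X_le hFh)]
  classical
  rw [finsum_eq_sum_of_support_subset (s := Finset.insertNone p.roots.toFinset),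
    Finset.sum_insertNone, hnone]
  · simp only [hsome]
    rw [← Nat.cast_sum, ← Nat.cast_add]
    congr 1
    have hcard : ∑ z ∈ p.roots.toFinset, p.rootMultiplicity z = p.natDegree := by
      simp only [← Polynomial.count_roots]
      rw [Multiset.toFinset_sum_count_eq]
      exact (IsAlgClosed.splits p).natDegree_eq_card_roots.symm
    rw [hcard]
    exact Nat.sub_add_cancel (natDegree_aeval_one_X_le hFh)
  · rintro (_ | z) hz
    · simp
    · have hz' : p.rootMultiplicity z ≠ 0 := fun h => hz (by simp [hsome, h])
      simpa [hp0] using hz'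

/-! ### Invariance under adding multiples -/

/-- The relation between `g`, `g + h * f` and `f` is pulled back to the chart and divided by the
common power `E ^ n`. -/
theorem exists_strictTransform_add_mul (P : Fin 2 → k) {f g h : MvPolynomial (Fin 2) k}
    (hf : f ≠ 0) (Q : Option k) {n a b : ℕ} (ha : mult P g = n + a)
    (hb : mult P (g + h * f) = n + b) :
    ∃ u, excVar Q ^ b * strictTransform P (g + h * f) Q =
      excVar Q ^ a * strictTransform P g Q + u * strictTransform P f Q := by
  have hE := pow_ne_zero n (excVar_ne_zero Q)
  have htot : excVar Q ^ (n + b) * strictTransform P (g + h * f) Q =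
      excVar Q ^ (n + a) * strictTransform P g Q + chartMap Q (translate P (h * f)) := by
    rw [← ha, ← hb, ← chartMap_translate, ← chartMap_translate, translate_add, map_add]
  by_cases h0 : h = 0
  · refine ⟨0, mul_left_cancel₀ hE ?_⟩
    have : chartMap Q (translate P (h * f)) = 0 := by simp [h0, translate]
    rw [this] at htot
    rw [zero_mul, add_zero, ← mul_assoc, ← mul_assoc, ← pow_add, ← pow_add, htot, add_zero]
  -- As a difference of two polynomials of multiplicity at least `n`, `h * f` has multiplicity at
  -- least `n` too.
  · have hn : n ≤ mult P (h * f) := by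
      refine le_mult_of_forall (mul_ne_zero h0 hf) fun d hd => ?_
      have h1 := homogeneousComponent_translate_of_lt (show d < mult P g by omega)
      have h2 := homogeneousComponent_translate_of_lt (show d < mult P (g + h * f) by omega)
      rwa [translate_add, map_add, h1, zero_add] at h2
    obtain ⟨c, hc⟩ := Nat.exists_eq_add_of_le hn
    rw [chartMap_translate, hc, strictTransform_mul P h0 hf] at htot
    refine ⟨excVar Q ^ c * strictTransform P h Q, mul_left_cancel₀ hE ?_⟩
    calc _ = excVar Q ^ (n + b) * strictTransform P (g + h * f) Q := by ring
      _ = _ := htot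
      _ = _ := by ring

theorem finsum_blowupNumber_pow_excVar_mul [IsAlgClosed k] (P : Fin 2 → k)
    {f g : MvPolynomial (Fin 2) k} (hf : f ≠ 0) (hg : g ≠ 0) (e : ℕ) :
    ∑ᶠ Q, blowupNumber (chartPoint Q) (strictTransform P f Q)
      (excVar Q ^ e * strictTransform P g Q) = ((e * mult P f : ℕ) : ℕ∞) +
      ∑ᶠ Q, blowupNumber (chartPoint Q) (strictTransform P f Q) (strictTransform P g Q) := by
  have hB := fun P f g => blowupNumber_eq_zero (k := k) (P := P) (f := f) (g := g)
  have hfin := finite_support_nearPoints hB P hf excVar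
  rw [finsum_congr fun Q => blowupNumber_pow_mul_right _ (strictTransform_ne_zero P hf Q)
    (excVar_ne_zero Q) (strictTransform_ne_zero P hg Q) e, finsum_add_distrib _
      (finite_support_nearPoints hB P hf _), ← mul_finsum' _ _ hfin,
    finsum_blowupNumber_excVar P hf, Nat.cast_mul]
  exact hfin.subset fun Q hQ h => hQ (by simp_all)

/-- Both numbers equal `m_P(f) n` plus a sum of blowup numbers one level up, of pairs that differ by
multiples of `f'`. Since `m_P(f) n > 0`, all these summands are smaller than `N`, and induction on
`N` matches them point by point. -/
theorem blowupNumber_add_mul_of_eq_coe [IsAlgClosed k] {P : Fin 2 → k}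
    {f g h : MvPolynomial (Fin 2) k} (hf : f ≠ 0) (hg : g ≠ 0) (hG : g + h * f ≠ 0) {N : ℕ}
    (hN : blowupNumber P f g = N) : blowupNumber P f (g + h * f) = N := by
  induction N using Nat.strong_induction_on generalizing P f g h with
  | _ N ih =>
  have hs : ¬ ShareComponent P f g := fun hs => by
    rw [blowupNumber_eq_top hs] at hN
    exact ENat.top_ne_natCast _ hN
  have hs' : ¬ ShareComponent P f (g + h * f) := by rwa [shareComponent_add_mul_iff]
  by_cases h0 : eval P f = 0 ∧ eval P g = 0
  swap
  · rw [← hN, blowupNumber_eq_zero h0, blowupNumber_eq_zero]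
    rintro ⟨h1, h2⟩
    refine h0 ⟨h1, ?_⟩
    simpa [h1] using h2
  have hG0 : eval P (g + h * f) = 0 := by simp [h0.1, h0.2]
  have hmf : 0 < mult P f := Nat.pos_of_ne_zero fun h' => (mult_eq_zero_iff hf).1 h' h0.1
  have hmg : 0 < mult P g := Nat.pos_of_ne_zero fun h' => (mult_eq_zero_iff hg).1 h' h0.2
  have hmG : 0 < mult P (g + h * f) :=
    Nat.pos_of_ne_zero fun h' => (mult_eq_zero_iff hG).1 h' hG0
  -- `n` is the smaller of the two multiplicities, so `a` or `b` is 0.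
  obtain ⟨n, a, b, hn, ha, hb⟩ : ∃ n a b, 0 < n ∧ mult P g = n + a ∧
      mult P (g + h * f) = n + b :=
    ⟨min (mult P g) (mult P (g + h * f)), mult P g - min (mult P g) (mult P (g + h * f)),
      mult P (g + h * f) - min (mult P g) (mult P (g + h * f)), by omega, by omega, by omega⟩
  rw [blowupNumber_eq_add_finsum hs hf hg] at hN
  rw [blowupNumber_eq_add_finsum hs' hf hG]
  have hA := finsum_blowupNumber_pow_excVar_mul P hf hg a
  have hsplit : ((mult P f * mult P g : ℕ) : ℕ∞) =
      ((mult P f * n : ℕ) : ℕ∞) + ((a * mult P f : ℕ) : ℕ∞) := by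
    rw [ha, ← Nat.cast_add]
    congr 1
    ring
  rw [hsplit, add_assoc, ← hA] at hN
  set S := ∑ᶠ Q, blowupNumber (chartPoint Q) (strictTransform P f Q)
    (excVar Q ^ a * strictTransform P g Q) with hS
  have hlt : ∀ Q, ∃ M : ℕ, M < N ∧ blowupNumber (chartPoint Q) (strictTransform P f Q)
      (excVar Q ^ a * strictTransform P g Q) = M := by
    intro Q
    have hle : blowupNumber (chartPoint Q) (strictTransform P f Q)
        (excVar Q ^ a * strictTransform P g Q) ≤ S :=
      single_le_finsum Q (finite_support_nearPoints (fun _ _ _ => blowupNumber_eq_zero) P hf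
        fun Q => excVar Q ^ a * strictTransform P g Q) fun _ => zero_le
    have hSt : S ≠ ⊤ := by
      intro h
      rw [h, add_top] at hN
      exact ENat.top_ne_natCast _ hN
    obtain ⟨s, hs⟩ := ENat.ne_top_iff_exists.1 hSt
    obtain ⟨M, hM⟩ := ENat.ne_top_iff_exists.1 (ne_top_of_le_ne_top hSt hle)
    refine ⟨M, ?_, hM.symm⟩
    rw [← hM, ← hs] at hle
    rw [← hs] at hN
    norm_cast at hle hN
    have := Nat.mul_pos hmf hn
    omega
  have hQ : ∀ Q, blowupNumber (chartPoint Q) (strictTransform P f Q)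
      (excVar Q ^ b * strictTransform P (g + h * f) Q) =
      blowupNumber (chartPoint Q) (strictTransform P f Q)
        (excVar Q ^ a * strictTransform P g Q) := by
    intro Q
    obtain ⟨M, hMN, hM⟩ := hlt Q
    obtain ⟨u, hu⟩ := exists_strictTransform_add_mul P hf Q ha hb
    rw [hM, hu]
    refine ih M hMN (strictTransform_ne_zero P hf Q) (mul_ne_zero
      (pow_ne_zero _ (excVar_ne_zero Q)) (strictTransform_ne_zero P hg Q)) ?_ hM
    rw [← hu]
    exact mul_ne_zero (pow_ne_zero _ (excVar_ne_zero Q)) (strictTransform_ne_zero P hG Q)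
  have hB := finsum_blowupNumber_pow_excVar_mul P hf hG b
  rw [finsum_congr hQ, ← hS] at hB
  rw [← hN, hB, ← add_assoc]
  congr 1
  rw [hb, ← Nat.cast_add]
  congr 1
  ring

theorem blowupNumber_add_mul [IsAlgClosed k] (P : Fin 2 → k) {f g h : MvPolynomial (Fin 2) k}
    (hf : f ≠ 0) (hg : g ≠ 0) (hG : g + h * f ≠ 0) :
    blowupNumber P f (g + h * f) = blowupNumber P f g := by
  by_cases h1 : blowupNumber P f g = ⊤
  · by_cases h2 : blowupNumber P f (g + h * f) = ⊤
    · rw [h1, h2]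
    · obtain ⟨N, hN⟩ := ENat.ne_top_iff_exists.1 h2
      -- If only the new number is known to be finite, the finite case is applied backwards, with
      -- `-h`.
      have hg' : g = (g + h * f) + (-h) * f := by ring
      have := blowupNumber_add_mul_of_eq_coe (h := -h) hf hG (hg' ▸ hg) hN.symm
      rw [← hg'] at this
      rw [this, hN]
  · obtain ⟨N, hN⟩ := ENat.ne_top_iff_exists.1 h1
    rw [blowupNumber_add_mul_of_eq_coe hf hg hG hN.symm, hN]

/-! ### Common tangents -/

/-- With `L` the linear form vanishing at `v` and `t` the form given by `w`, so that `t(v) = 1`, the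
coordinate vector is congruent to `t v` modulo `L`. Hence `F` is congruent to `t ^ d F(v) = 0`. -/
theorem dvd_of_eval_eq_zero {F : MvPolynomial (Fin 2) k} {d : ℕ} (hF : F.IsHomogeneous d)
    {v w : Fin 2 → k} (hvw : v 0 * w 0 + v 1 * w 1 = 1) (h : eval v F = 0) :
    C (v 1) * X 0 + C (-v 0) * X 1 ∣ F := by
  set L : MvPolynomial (Fin 2) k := C (v 1) * X 0 + C (-v 0) * X 1 with hL
  set t : MvPolynomial (Fin 2) k := C (w 0) * X 0 + C (w 1) * X 1 with ht
  have hhom : aeval (fun i => t * C (v i)) F = t ^ d * C (eval v F) := by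
    have h1 : C (eval v F) = aeval (fun i => (C (v i) : MvPolynomial (Fin 2) k)) F := by
      rw [aeval_def, eval_eq', eval₂_eq', map_sum]
      simp
    rw [h1, aeval_def, aeval_def, eval₂_eq', eval₂_eq', Finset.mul_sum]
    refine Finset.sum_congr rfl fun s hs => ?_
    rw [Fin.prod_univ_two, Fin.prod_univ_two,
      ← add_eq_of_coeff_ne_zero hF (mem_support_iff.1 hs)]
    ring_nf
  rw [h, C_0, mul_zero] at hhom
  have hCvw : (C (v 0) * C (w 0) + C (v 1) * C (w 1) : MvPolynomial (Fin 2) k) = 1 := by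
    rw [← C_mul, ← C_mul, ← C_add, hvw, C_1]
  have hmk : (Ideal.Quotient.mkₐ k (Ideal.span {L})) F =
      (Ideal.Quotient.mkₐ k (Ideal.span {L})) (aeval (fun i => t * C (v i)) F) := by
    have : Ideal.Quotient.mkₐ k (Ideal.span {L}) =
        (Ideal.Quotient.mkₐ k (Ideal.span {L})).comp (aeval fun i => t * C (v i)) := by
      apply MvPolynomial.algHom_ext
      intro i
      rw [AlgHom.comp_apply, aeval_X, Ideal.Quotient.mkₐ_eq_mk, Ideal.Quotient.eq,
        Ideal.mem_span_singleton]
      fin_cases i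
      · refine ⟨C (w 1), ?_⟩
        simp only [hL, ht, Fin.zero_eta, C_neg]
        linear_combination (-X 0) * hCvw
      · refine ⟨-C (w 0), ?_⟩
        simp only [hL, ht, Fin.mk_one, C_neg]
        linear_combination (-X 1) * hCvw
    exact DFunLike.congr_fun this F
  rw [hhom, map_zero, Ideal.Quotient.mkₐ_eq_mk, Ideal.Quotient.eq_zero_iff_mem,
    Ideal.mem_span_singleton] at hmk
  exact hmk

theorem haveCommonTangent_iff {P : Fin 2 → k} {f g : MvPolynomial (Fin 2) k} :
    HaveCommonTangent P f g ↔ (commonNearPoints P f g).Nonempty := by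
  constructor
  · rintro ⟨a, b, hab, hf, hg⟩
    obtain ⟨Q, hQ⟩ : ∃ Q : Option k,
        eval (direction Q) (C a * X 0 + C b * X 1 : MvPolynomial (Fin 2) k) = 0 := by
      by_cases hb : b = 0
      · exact ⟨none, by simp [direction, hb]⟩
      · refine ⟨some (-a / b), ?_⟩
        have : b * (-a / b) = -a := mul_div_cancel₀ _ hb
        simp [direction, this]
    refine ⟨Q, mem_commonNearPoints_iff.2 ⟨?_, ?_⟩⟩
    · obtain ⟨u, hu⟩ := hf
      rw [hu, map_mul, hQ, zero_mul]
    · obtain ⟨u, hu⟩ := hg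
      rw [hu, map_mul, hQ, zero_mul]
  · rintro ⟨Q, hQ⟩
    rw [mem_commonNearPoints_iff] at hQ
    obtain ⟨w, hw⟩ : ∃ w : Fin 2 → k, direction Q 0 * w 0 + direction Q 1 * w 1 = 1 := by
      cases Q
      · exact ⟨![0, 1], by simp [direction]⟩
      · exact ⟨![1, 0], by simp [direction]⟩
    refine ⟨direction Q 1, -direction Q 0, ?_,
      dvd_of_eval_eq_zero (lowestForm_isHomogeneous P f) hw hQ.1,
      dvd_of_eval_eq_zero (lowestForm_isHomogeneous P g) hw hQ.2⟩
    cases Q <;> simp [direction]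

/-- Otherwise the intersection with the exceptional line would be empty, although it has `m_P(f) >
0` points. -/
theorem exists_nearPoint [IsAlgClosed k] {P : Fin 2 → k} {f : MvPolynomial (Fin 2) k}
    (hf : f ≠ 0) (h : eval P f = 0) : ∃ Q, eval (direction Q) (lowestForm P f) = 0 := by
  by_contra! hc
  have h1 := finsum_blowupNumber_excVar P hf
  rw [finsum_eq_zero_of_forall_eq_zero, eq_comm, Nat.cast_eq_zero, mult_eq_zero_iff hf] at h1
  · exact h1 h
  · intro Q
    apply blowupNumber_eq_zero
    rw [eval_chartPoint_strictTransform]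
    exact fun h' => hc Q h'.1

theorem ShareComponent.haveCommonTangent [IsAlgClosed k] {P : Fin 2 → k}
    {f g : MvPolynomial (Fin 2) k} (hf : f ≠ 0) (hg : g ≠ 0) (h : ShareComponent P f g) :
    HaveCommonTangent P f g := by
  obtain ⟨d, -, ⟨u, rfl⟩, ⟨v, rfl⟩, h0⟩ := h
  obtain ⟨Q, hQ⟩ := exists_nearPoint (left_ne_zero_of_mul hf) h0
  rw [← eval_chartPoint_strictTransform] at hQ
  refine haveCommonTangent_iff.2 ⟨Q, ?_, ?_⟩
  · rw [strictTransform_mul P (left_ne_zero_of_mul hf) (right_ne_zero_of_mul hf), map_mul, hQ,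
      zero_mul]
  · rw [strictTransform_mul P (left_ne_zero_of_mul hg) (right_ne_zero_of_mul hg), map_mul, hQ,
      zero_mul]

theorem mult_mul_mult_le_blowupNumber (P : Fin 2 → k) {f g : MvPolynomial (Fin 2) k}
    (hf : f ≠ 0) (hg : g ≠ 0) : ((mult P f * mult P g : ℕ) : ℕ∞) ≤ blowupNumber P f g := by
  by_cases hs : ShareComponent P f g
  · rw [blowupNumber_eq_top hs]
    exact le_top
  · rw [blowupNumber_eq_add_finsum hs hf hg]
    exact le_self_add

theorem blowupNumber_eq_zero_iff {P : Fin 2 → k} {f g : MvPolynomial (Fin 2) k}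
    (hf : f ≠ 0) (hg : g ≠ 0) :
    blowupNumber P f g = 0 ↔ eval P f ≠ 0 ∨ eval P g ≠ 0 := by
  constructor
  · intro h
    have h1 := mult_mul_mult_le_blowupNumber P hf hg
    rw [h, nonpos_iff_eq_zero, Nat.cast_eq_zero, mul_eq_zero, mult_eq_zero_iff hf,
      mult_eq_zero_iff hg] at h1
    exact h1
  · intro h
    apply blowupNumber_eq_zero
    tauto

theorem blowupNumber_eq_mult_mul_mult_iff [IsAlgClosed k] {P : Fin 2 → k}
    {f g : MvPolynomial (Fin 2) k} (hf : f ≠ 0) (hg : g ≠ 0) :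
    blowupNumber P f g = ((mult P f * mult P g : ℕ) : ℕ∞) ↔ ¬ HaveCommonTangent P f g := by
  by_cases hs : ShareComponent P f g
  · rw [blowupNumber_eq_top hs]
    exact iff_of_false (ENat.top_ne_natCast _) (not_not.2 (hs.haveCommonTangent hf hg))
  rw [blowupNumber_eq_add_finsum hs hf hg, haveCommonTangent_iff]
  constructor
  · rintro h ⟨Q, hQ⟩
    have hfin := finite_support_nearPoints (k := k) (fun _ _ _ => blowupNumber_eq_zero) P hf
      (strictTransform P g)
    have h1 := single_le_finsum Q hfin fun _ => zero_le
    have h2 : ∑ᶠ Q, blowupNumber (chartPoint Q) (strictTransform P f Q) (strictTransform P g Q) =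
        0 := by
      exact ENat.add_right_injective_of_ne_top (ENat.natCast_ne_top _) (h.trans (add_zero _).symm)
    rw [h2, nonpos_iff_eq_zero, blowupNumber_eq_zero_iff (strictTransform_ne_zero P hf Q)
      (strictTransform_ne_zero P hg Q)] at h1
    exact h1.elim (fun h => h hQ.1) fun h => h hQ.2
  · intro h
    rw [finsum_eq_zero_of_forall_eq_zero, add_zero]
    intro Q
    exact blowupNumber_eq_zero fun h' => h ⟨Q, h'⟩

/-! ### Uniqueness of local intersection numbers -/

/-- The properties of an intersection number at a single point that determine its finite
values. -/
structure IsLocalIntersectionNumber (P : Fin 2 → k)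
    (J : MvPolynomial (Fin 2) k → MvPolynomial (Fin 2) k → ℕ∞) : Prop where
  zero : ∀ {f g}, f ≠ 0 → g ≠ 0 → eval P g ≠ 0 → J f g = 0
  symm : ∀ {f g}, f ≠ 0 → g ≠ 0 → J f g = J g f
  mul : ∀ {f g₁ g₂}, f ≠ 0 → g₁ ≠ 0 → g₂ ≠ 0 → J f (g₁ * g₂) = J f g₁ + J f g₂
  add_mul : ∀ {f g} (h), f ≠ 0 → g ≠ 0 → g + h * f ≠ 0 → J f (g + h * f) = J f g
  axes : J (X 0 - C (P 0)) (X 1 - C (P 1)) = 1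

/-- Two intersection numbers of `f` and `g` agree and are finite. -/
def AgreeFinite (J₁ J₂ : MvPolynomial (Fin 2) k → MvPolynomial (Fin 2) k → ℕ∞)
    (f g : MvPolynomial (Fin 2) k) : Prop :=
  J₁ f g = J₂ f g ∧ J₁ f g ≠ ⊤

theorem X_sub_C_dvd_sub (P : Fin 2 → k) (f : MvPolynomial (Fin 2) k) :
    X 0 - C (P 0) ∣ f - Polynomial.aeval (X 1) (lineRestrict 0 P f) := by
  have : Ideal.Quotient.mkₐ k (Ideal.span {(X 0 - C (P 0) : MvPolynomial (Fin 2) k)}) =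
      ((Ideal.Quotient.mkₐ k (Ideal.span {(X 0 - C (P 0) : MvPolynomial (Fin 2) k)})).comp
        (Polynomial.aeval (X 1))).comp (lineRestrict 0 P) := by
    apply MvPolynomial.algHom_ext
    intro i
    rw [AlgHom.comp_apply, AlgHom.comp_apply, Ideal.Quotient.mkₐ_eq_mk, Ideal.Quotient.eq,
      Ideal.mem_span_singleton]
    fin_cases i <;> simp [lineRestrict, algebraMap_eq]
  have h := DFunLike.congr_fun this f
  rw [AlgHom.comp_apply, AlgHom.comp_apply, Ideal.Quotient.mkₐ_eq_mk, Ideal.Quotient.eq,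
    Ideal.mem_span_singleton] at h
  exact h

theorem aeval_X_eq_prod [IsAlgClosed k] (i : Fin 2) (p : Polynomial k) :
    (Polynomial.aeval (X i) p : MvPolynomial (Fin 2) k) =
      C p.leadingCoeff * (p.roots.map fun z => X i - C z).prod := by
  conv_lhs => rw [(IsAlgClosed.splits p).eq_prod_roots]
  rw [map_mul, Polynomial.aeval_C, algebraMap_eq, map_multiset_prod, Multiset.map_map]
  congr 3
  funext z
  simp [algebraMap_eq]

/-- A polynomial in `x` alone splits into vertical lines, and only `x = P 0` passes through `P`. -/
theorem X_sub_C_dvd_of_shareComponent [IsAlgClosed k] {P : Fin 2 → k} {p : Polynomial k}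
    (hp : p ≠ 0) {f : MvPolynomial (Fin 2) k}
    (h : ShareComponent P (Polynomial.aeval (X 0) p) f) : X 0 - C (P 0) ∣ f := by
  obtain ⟨d, hd, h1, h2, h0⟩ := h
  rw [aeval_X_eq_prod] at h1
  rcases hd.prime.dvd_or_dvd h1 with h1 | h1
  · exact absurd (isUnit_of_dvd_unit h1
      ((Polynomial.leadingCoeff_ne_zero.2 hp).isUnit.map C)) hd.not_isUnit
  · obtain ⟨z, -, hz⟩ := hd.prime.exists_mem_multiset_map_dvd h1
    have hz0 : P 0 = z := by
      obtain ⟨u, hu⟩ := hz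
      have := congrArg (eval P) hu
      rw [map_mul, h0, zero_mul] at this
      simpa [sub_eq_zero] using this
    rw [hz0]
    exact ((hd.associated_of_dvd (X_sub_C_irreducible 0 z) hz).symm.dvd).trans h2

theorem exists_eq_X_sub_C_pow_mul (c : k) {g : MvPolynomial (Fin 2) k} (hg : g ≠ 0) :
    ∃ e g₀, g = (X 0 - C c) ^ e * g₀ ∧ ¬ X 0 - C c ∣ g₀ := by
  obtain ⟨g₀, h⟩ := (FiniteMultiplicity.of_not_isUnit
    (X_sub_C_irreducible (0 : Fin 2) c).not_isUnit hg).exists_eq_pow_mul_and_not_dvd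
  exact ⟨_, g₀, h⟩

theorem equivMvPolynomial_C (p : Polynomial k) :
    Polynomial.Bivariate.equivMvPolynomial k (Polynomial.C p) = Polynomial.aeval (X 0) p := by
  induction p using Polynomial.induction_on' with
  | add p q hp hq => rw [Polynomial.C_add, map_add, map_add, hp, hq]
  | monomial n a =>
    rw [← Polynomial.C_mul_X_pow_eq_monomial]
    simp [algebraMap_eq]

namespace AgreeFinite

variable {P : Fin 2 → k} {J₁ J₂ : MvPolynomial (Fin 2) k → MvPolynomial (Fin 2) k → ℕ∞}
  {f g g₁ g₂ h : MvPolynomial (Fin 2) k}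

theorem of_eval_ne_zero (h₁ : IsLocalIntersectionNumber P J₁)
    (h₂ : IsLocalIntersectionNumber P J₂) (hf : f ≠ 0) (hg : g ≠ 0) (h0 : eval P g ≠ 0) :
    AgreeFinite J₁ J₂ f g := by
  rw [AgreeFinite, h₁.zero hf hg h0, h₂.zero hf hg h0]
  exact ⟨rfl, ENat.zero_ne_top⟩

theorem symm (h₁ : IsLocalIntersectionNumber P J₁) (h₂ : IsLocalIntersectionNumber P J₂)
    (hf : f ≠ 0) (hg : g ≠ 0) (H : AgreeFinite J₁ J₂ f g) : AgreeFinite J₁ J₂ g f := by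
  rwa [AgreeFinite, h₁.symm hg hf, h₂.symm hg hf]

theorem mul (h₁ : IsLocalIntersectionNumber P J₁) (h₂ : IsLocalIntersectionNumber P J₂)
    (hf : f ≠ 0) (hg₁ : g₁ ≠ 0) (hg₂ : g₂ ≠ 0) (H₁ : AgreeFinite J₁ J₂ f g₁)
    (H₂ : AgreeFinite J₁ J₂ f g₂) : AgreeFinite J₁ J₂ f (g₁ * g₂) := by
  rw [AgreeFinite, h₁.mul hf hg₁ hg₂, h₂.mul hf hg₁ hg₂, H₁.1, H₂.1]
  exact ⟨rfl, WithTop.add_ne_top.2 ⟨H₁.1 ▸ H₁.2, H₂.1 ▸ H₂.2⟩⟩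

theorem pow (h₁ : IsLocalIntersectionNumber P J₁) (h₂ : IsLocalIntersectionNumber P J₂)
    (hf : f ≠ 0) (hg : g ≠ 0) (H : AgreeFinite J₁ J₂ f g) (e : ℕ) :
    AgreeFinite J₁ J₂ f (g ^ e) := by
  induction e with
  | zero => exact of_eval_ne_zero h₁ h₂ hf (by simp) (by simp)
  | succ e ih =>
    rw [pow_succ]
    exact mul h₁ h₂ hf (pow_ne_zero e hg) hg ih H

/-- Cancelling a summand in `ℕ∞` needs it to be finite, which is why agreement and finiteness are
carried together. -/
theorem of_mul (h₁ : IsLocalIntersectionNumber P J₁) (h₂ : IsLocalIntersectionNumber P J₂)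
    (hf : f ≠ 0) (hg₁ : g₁ ≠ 0) (hg₂ : g₂ ≠ 0) (H : AgreeFinite J₁ J₂ f (g₁ * g₂))
    (H₁ : AgreeFinite J₁ J₂ f g₁) : AgreeFinite J₁ J₂ f g₂ := by
  obtain ⟨h, htop⟩ := H
  rw [h₁.mul hf hg₁ hg₂, h₂.mul hf hg₁ hg₂, ← H₁.1] at h
  rw [h₁.mul hf hg₁ hg₂] at htop
  exact ⟨ENat.add_right_injective_of_ne_top H₁.2 h, (WithTop.add_ne_top.1 htop).2⟩

theorem of_add_mul (h₁ : IsLocalIntersectionNumber P J₁) (h₂ : IsLocalIntersectionNumber P J₂)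
    (hf : f ≠ 0) (hg : g ≠ 0) (hG : g + h * f ≠ 0) (H : AgreeFinite J₁ J₂ f (g + h * f)) :
    AgreeFinite J₁ J₂ f g := by
  rwa [AgreeFinite, h₁.add_mul h hf hg hG, h₂.add_mul h hf hg hG] at H

theorem aeval_X [IsAlgClosed k] (h₁ : IsLocalIntersectionNumber P J₁)
    (h₂ : IsLocalIntersectionNumber P J₂) (hf : f ≠ 0) (i : Fin 2)
    (H : AgreeFinite J₁ J₂ f (X i - C (P i))) {p : Polynomial k} (hp : p ≠ 0) :
    Polynomial.aeval (X i : MvPolynomial (Fin 2) k) p ≠ 0 ∧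
      AgreeFinite J₁ J₂ f (Polynomial.aeval (X i) p) := by
  have hs : ∀ s : Multiset k, (s.map fun z => (X i - C z : MvPolynomial (Fin 2) k)).prod ≠ 0 ∧
      AgreeFinite J₁ J₂ f (s.map fun z => X i - C z).prod := by
    intro s
    induction s using Multiset.induction with
    | empty => exact ⟨by simp, of_eval_ne_zero h₁ h₂ hf (by simp) (by simp)⟩
    | cons z s ih =>
      rw [Multiset.map_cons, Multiset.prod_cons]
      refine ⟨mul_ne_zero (X_sub_C_ne_zero i z) ih.1,
        mul h₁ h₂ hf (X_sub_C_ne_zero i z) ih.1 ?_ ih.2⟩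
      by_cases hz : z = P i
      · rwa [hz]
      · refine of_eval_ne_zero h₁ h₂ hf (X_sub_C_ne_zero i z) ?_
        simpa [sub_eq_zero] using fun h => hz h.symm
  have hC : (C p.leadingCoeff : MvPolynomial (Fin 2) k) ≠ 0 := by simpa using hp
  rw [aeval_X_eq_prod]
  exact ⟨mul_ne_zero hC (hs _).1,
    mul h₁ h₂ hf hC (hs _).1 (of_eval_ne_zero h₁ h₂ hf hC (by simpa using hp)) (hs _).2⟩

/-- Modulo `x - P 0`, `f` becomes a polynomial in `y`, a product of horizontal lines up to a
constant; only the one through `P` counts, and its value is normalized by the axes. -/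
theorem X_sub_C_left [IsAlgClosed k] (h₁ : IsLocalIntersectionNumber P J₁)
    (h₂ : IsLocalIntersectionNumber P J₂) (hf : ¬ X 0 - C (P 0) ∣ f) :
    AgreeFinite J₁ J₂ (X 0 - C (P 0)) f := by
  obtain ⟨q, hq⟩ := X_sub_C_dvd_sub P f
  have hL := X_sub_C_ne_zero (0 : Fin 2) (P 0)
  have hp : lineRestrict 0 P f ≠ 0 := by
    intro h
    rw [h, map_zero, sub_zero] at hq
    exact hf ⟨q, hq⟩
  have hf0 : f ≠ 0 := by
    rintro rfl
    exact hf (dvd_zero _)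
  have H := aeval_X h₁ h₂ hL 1 ⟨by rw [h₁.axes, h₂.axes], by rw [h₁.axes]; exact ENat.one_ne_top⟩ hp
  have he : f + (-q) * (X 0 - C (P 0)) = Polynomial.aeval (X 1) (lineRestrict 0 P f) := by
    linear_combination hq
  rw [← he] at H
  exact of_add_mul h₁ h₂ hL hf0 H.1 H.2

theorem X_sub_C_right [IsAlgClosed k] (h₁ : IsLocalIntersectionNumber P J₁)
    (h₂ : IsLocalIntersectionNumber P J₂) (hf : ¬ X 0 - C (P 0) ∣ f) :
    AgreeFinite J₁ J₂ f (X 0 - C (P 0)) :=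
  symm h₁ h₂ (X_sub_C_ne_zero _ _) (fun h => hf (h ▸ dvd_zero _)) (X_sub_C_left h₁ h₂ hf)

/-- Pseudo-division in `k[x][y]`, by induction on the sum of the `y`-degrees. Multiplying by the
leading coefficient, a polynomial in `x`, costs a finite and known amount because `x - P 0` does not
divide `p`. -/
theorem of_not_dvd [IsAlgClosed k] (h₁ : IsLocalIntersectionNumber P J₁)
    (h₂ : IsLocalIntersectionNumber P J₂) {p q : Polynomial (Polynomial k)}
    (hp : ¬ X 0 - C (P 0) ∣ Polynomial.Bivariate.equivMvPolynomial k p)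
    (hq : ¬ X 0 - C (P 0) ∣ Polynomial.Bivariate.equivMvPolynomial k q)
    (hs : ¬ ShareComponent P (Polynomial.Bivariate.equivMvPolynomial k p)
      (Polynomial.Bivariate.equivMvPolynomial k q)) :
    AgreeFinite J₁ J₂ (Polynomial.Bivariate.equivMvPolynomial k p)
      (Polynomial.Bivariate.equivMvPolynomial k q) := by
  set ψ := Polynomial.Bivariate.equivMvPolynomial k with hψ
  induction hn : p.natDegree + q.natDegree using Nat.strong_induction_on generalizing p q with
  | _ n ih =>
  have hL := X_sub_C_ne_zero (0 : Fin 2) (P 0)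
  have hfp : ψ p ≠ 0 := fun h => hp (h ▸ dvd_zero _)
  have hfq : ψ q ≠ 0 := fun h => hq (h ▸ dvd_zero _)
  wlog hpq : p.natDegree ≤ q.natDegree generalizing p q
  · exact symm h₁ h₂ hfq hfp (this hq hp (fun h => hs h.symm) (by omega) hfq hfp (by omega))
  have hp0 : p ≠ 0 := fun h => hfp (by rw [h, map_zero])
  have hq0 : q ≠ 0 := fun h => hfq (by rw [h, map_zero])
  by_cases hdeg : p.natDegree = 0
  · obtain ⟨a, rfl⟩ := Polynomial.natDegree_eq_zero.1 hdeg
    have ha : a ≠ 0 := fun h => hp0 (by rw [h, Polynomial.C_0])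
    have hψa : ψ (Polynomial.C a) = Polynomial.aeval (X 0) a := equivMvPolynomial_C a
    rw [hψa] at hfp ⊢
    exact symm h₁ h₂ hfq hfp (aeval_X h₁ h₂ hfq 0 (X_sub_C_right h₁ h₂ hq) ha).2
  by_cases hev : eval P (ψ p) = 0
  swap
  · exact symm h₁ h₂ hfq hfp (of_eval_ne_zero h₁ h₂ hfq hfp hev)
  have hlp : p.leadingCoeff ≠ 0 := Polynomial.leadingCoeff_ne_zero.2 hp0
  have hlq : q.leadingCoeff ≠ 0 := Polynomial.leadingCoeff_ne_zero.2 hq0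
  have hlead := aeval_X h₁ h₂ hfp 0 (X_sub_C_right h₁ h₂ hp) hlp
  rw [← equivMvPolynomial_C, ← hψ] at hlead
  set c := Polynomial.C q.leadingCoeff * Polynomial.X ^ (q.natDegree - p.natDegree) with hc
  -- The leading terms in `y` cancel, so no division in `k[x]` is needed.
  set r := Polynomial.C p.leadingCoeff * q - c * p with hr
  have hψr : ψ r = ψ (Polynomial.C p.leadingCoeff) * ψ q + (-ψ c) * ψ p := by
    rw [hr, map_sub, map_mul, map_mul]
    ring
  have hsr : ¬ ShareComponent P (ψ p) (ψ r) := by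
    rw [hψr, shareComponent_add_mul_iff, shareComponent_comm, shareComponent_mul_left_iff, not_or]
    refine ⟨fun h => hp (X_sub_C_dvd_of_shareComponent hlp ?_), fun h => hs h.symm⟩
    rwa [← equivMvPolynomial_C]
  have hψr0 : ψ r ≠ 0 := ne_zero_of_not_shareComponent (fun h => hsr h.symm) hev
  have hr0 : r ≠ 0 := fun h => hψr0 (by rw [h, map_zero])
  have hrdeg : r.natDegree < q.natDegree := by
    have hd1 : (Polynomial.C p.leadingCoeff * q).degree = q.degree := Polynomial.degree_C_mul hlp
    have hd2 : (c * p).degree = q.degree := by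
      rw [hc, Polynomial.degree_mul, Polynomial.degree_C_mul_X_pow _ hlq,
        Polynomial.degree_eq_natDegree hp0, Polynomial.degree_eq_natDegree hq0]
      norm_cast
      omega
    have := Polynomial.degree_sub_lt_left (hd1.trans hd2.symm)
      (mul_ne_zero (Polynomial.C_ne_zero.2 hlp) hq0) (by
        rw [hc, Polynomial.leadingCoeff_mul, Polynomial.leadingCoeff_C,
          Polynomial.leadingCoeff_mul, Polynomial.leadingCoeff_mul, Polynomial.leadingCoeff_C,
          Polynomial.leadingCoeff_X_pow, mul_one, mul_comm])
    rw [hd1] at this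
    exact Polynomial.natDegree_lt_natDegree hr0 this
  -- The remainder may be divisible by `x - P 0`; removing these factors restores the induction
  -- hypothesis without raising the `y`-degree.
  obtain ⟨e, g₀, hg₀, hdvd⟩ := exists_eq_X_sub_C_pow_mul (P 0) hψr0
  have hg₀0 : g₀ ≠ 0 := fun h => hdvd (h ▸ dvd_zero _)
  have hr₀ : ψ (ψ.symm g₀) = g₀ := ψ.apply_symm_apply g₀
  have hle : (ψ.symm g₀).natDegree ≤ r.natDegree := by
    refine Polynomial.natDegree_le_of_dvd ?_ hr0
    rw [← ψ.symm_apply_apply r]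
    exact map_dvd ψ.symm (hg₀ ▸ dvd_mul_left _ _)
  have H₀ := ih (p.natDegree + (ψ.symm g₀).natDegree) (by omega) (p := p) (q := ψ.symm g₀) hp
    (by rwa [hr₀]) (by
      rw [hr₀]
      rintro ⟨d, hd, hdp, hdg, hd0⟩
      exact hsr ⟨d, hd, hdp, hg₀ ▸ hdg.mul_left _, hd0⟩) rfl
  rw [hr₀] at H₀
  have Hr : AgreeFinite J₁ J₂ (ψ p) (ψ r) := by
    rw [hg₀]
    exact mul h₁ h₂ hfp (pow_ne_zero e hL) hg₀0
      (pow h₁ h₂ hfp hL (X_sub_C_right h₁ h₂ hp) e) H₀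
  rw [hψr] at Hr hψr0
  exact of_mul h₁ h₂ hfp hlead.1 hfq
    (of_add_mul h₁ h₂ hfp (mul_ne_zero hlead.1 hfq) hψr0 Hr) hlead.2

theorem of_not_dvd_left [IsAlgClosed k] (h₁ : IsLocalIntersectionNumber P J₁)
    (h₂ : IsLocalIntersectionNumber P J₂) (hf : ¬ X 0 - C (P 0) ∣ f) (hg : g ≠ 0)
    (hs : ¬ ShareComponent P f g) : AgreeFinite J₁ J₂ f g := by
  have hL := X_sub_C_ne_zero (0 : Fin 2) (P 0)
  have hf0 : f ≠ 0 := fun h => hf (h ▸ dvd_zero _)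
  obtain ⟨e, g₀, rfl, hdvd⟩ := exists_eq_X_sub_C_pow_mul (P 0) hg
  have H := of_not_dvd h₁ h₂ (p := (Polynomial.Bivariate.equivMvPolynomial k).symm f)
    (q := (Polynomial.Bivariate.equivMvPolynomial k).symm g₀)
  simp only [AlgEquiv.apply_symm_apply] at H
  refine mul h₁ h₂ hf0 (pow_ne_zero e hL) (right_ne_zero_of_mul hg)
    (pow h₁ h₂ hf0 hL (X_sub_C_right h₁ h₂ hf) e) (H hf hdvd ?_)
  rintro ⟨d, hd, hdp, hdg, hd0⟩
  exact hs ⟨d, hd, hdp, hdg.mul_left _, hd0⟩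

/-- Local intersection numbers are finite and unique for curves without a common component
through the point. -/
theorem of_not_shareComponent [IsAlgClosed k] (h₁ : IsLocalIntersectionNumber P J₁)
    (h₂ : IsLocalIntersectionNumber P J₂) (hf : f ≠ 0) (hg : g ≠ 0)
    (hs : ¬ ShareComponent P f g) : AgreeFinite J₁ J₂ f g := by
  -- The line `x = P 0` cannot be a component of both curves, so up to symmetry it is not one of
  -- `f`.
  by_cases hd : X 0 - C (P 0) ∣ f
  · refine symm h₁ h₂ hg hf (of_not_dvd_left h₁ h₂ (fun hd' => ?_) hf fun h => hs h.symm)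
    exact hs (shareComponent_of_dvd hd hd' (by simp))
  · exact of_not_dvd_left h₁ h₂ hd hg hs

end AgreeFinite

theorem not_haveCommonTangent_axes (P : Fin 2 → k) :
    ¬ HaveCommonTangent P (X 0 - C (P 0)) (X 1 - C (P 1)) := by
  rw [haveCommonTangent_iff]
  rintro ⟨Q, hQ⟩
  rw [mem_commonNearPoints_iff, lowestForm_X_sub_C, lowestForm_X_sub_C] at hQ
  cases Q <;> simp [direction] at hQ

theorem isLocalIntersectionNumber_blowupNumber [IsAlgClosed k] (P : Fin 2 → k) :
    IsLocalIntersectionNumber P (blowupNumber P) where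
  zero _ _ h := blowupNumber_eq_zero fun h' => h h'.2
  symm _ _ := blowupNumber_comm _ _ _
  mul := blowupNumber_mul_right P
  add_mul _ := blowupNumber_add_mul P
  axes := by
    rw [(blowupNumber_eq_mult_mul_mult_iff (X_sub_C_ne_zero _ _) (X_sub_C_ne_zero _ _)).2
      (not_haveCommonTangent_axes P), mult_X_sub_C, mult_X_sub_C]
    rfl

/-- Comparing the blowup number with itself yields the finiteness half of `AgreeFinite`. -/
theorem blowupNumber_eq_top_iff [IsAlgClosed k] {P : Fin 2 → k} {f g : MvPolynomial (Fin 2) k}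
    (hf : f ≠ 0) (hg : g ≠ 0) : blowupNumber P f g = ⊤ ↔ ShareComponent P f g := by
  refine ⟨fun h => ?_, blowupNumber_eq_top⟩
  by_contra hs
  have hB := isLocalIntersectionNumber_blowupNumber P
  exact (AgreeFinite.of_not_shareComponent hB hB hf hg hs).2 h

/-! ### Affine changes of coordinates -/

theorem affine_symm_apply (φ : (Fin 2 → k) ≃ᵃ[k] (Fin 2 → k)) (v Q : Fin 2 → k) :
    φ.symm (v + Q) = φ.symm.linear v + φ.symm Q := by
  have := φ.symm.map_vadd Q v
  simpa [vadd_eq_add] using this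

theorem sum_linear_single (L : (Fin 2 → k) ≃ₗ[k] (Fin 2 → k)) (Q : Fin 2 → k) (i : Fin 2) :
    ∑ j, L (Pi.single j 1) i * Q j = L Q i := by
  have : Q = ∑ j, Q j • Pi.single j (1 : k) := by
    funext j
    fin_cases j <;> simp
  conv_rhs => rw [this, map_sum]
  simp [mul_comm]

theorem eval_affineTransform (φ : (Fin 2 → k) ≃ᵃ[k] (Fin 2 → k)) (Q : Fin 2 → k)
    (f : MvPolynomial (Fin 2) k) : eval Q (affineTransform φ f) = eval (φ.symm Q) f := by
  have : (aeval Q : MvPolynomial (Fin 2) k →ₐ[k] k).comp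
      (aeval fun i => C (φ.symm 0 i) + ∑ j, C (φ.symm.linear (Pi.single j 1) i) * X j) =
      aeval (φ.symm Q) := by
    apply MvPolynomial.algHom_ext
    intro i
    have h1 := affine_symm_apply φ Q 0
    rw [add_zero] at h1
    rw [AlgHom.comp_apply, aeval_X, aeval_X, h1, Pi.add_apply, ← sum_linear_single]
    simp [add_comm]
  exact DFunLike.congr_fun this f

theorem affineTransform_ne_zero [Infinite k] (φ : (Fin 2 → k) ≃ᵃ[k] (Fin 2 → k))
    {f : MvPolynomial (Fin 2) k} (hf : f ≠ 0) : affineTransform φ f ≠ 0 := by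
  intro h
  apply hf
  apply MvPolynomial.funext
  intro Q
  have := eval_affineTransform φ (φ Q) f
  rw [h, AffineEquiv.symm_apply_apply, map_zero] at this
  rw [← this, map_zero]

theorem affineTransform_mul (φ : (Fin 2 → k) ≃ᵃ[k] (Fin 2 → k)) (f g : MvPolynomial (Fin 2) k) :
    affineTransform φ (f * g) = affineTransform φ f * affineTransform φ g := map_mul _ _ _

theorem affineTransform_add (φ : (Fin 2 → k) ≃ᵃ[k] (Fin 2 → k)) (f g : MvPolynomial (Fin 2) k) :
    affineTransform φ (f + g) = affineTransform φ f + affineTransform φ g := map_add _ _ _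

theorem ShareComponent.affineTransform {P : Fin 2 → k} {f g : MvPolynomial (Fin 2) k}
    (h : ShareComponent P f g) (φ : (Fin 2 → k) ≃ᵃ[k] (Fin 2 → k)) :
    ShareComponent (φ P) (affineTransform φ f) (affineTransform φ g) := by
  obtain ⟨d, -, ⟨u, rfl⟩, ⟨v, rfl⟩, h0⟩ := h
  refine shareComponent_of_dvd (d := PlaneIntersection.affineTransform φ d) ?_ ?_ ?_
  · rw [affineTransform_mul]
    exact dvd_mul_right _ _
  · rw [affineTransform_mul]
    exact dvd_mul_right _ _
  · rw [eval_affineTransform, AffineEquiv.symm_apply_apply, h0]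

theorem translate_affineTransform_X_sub_C [Infinite k] (φ : (Fin 2 → k) ≃ᵃ[k] (Fin 2 → k))
    (P : Fin 2 → k) (i : Fin 2) :
    translate (φ P) (affineTransform φ (X i - C (P i))) =
      ∑ j, C (φ.symm.linear (Pi.single j 1) i) * X j := by
  apply MvPolynomial.funext
  intro Q
  rw [eval_translate, eval_affineTransform, affine_symm_apply, AffineEquiv.symm_apply_apply,
    map_sub, eval_X, eval_C, Pi.add_apply, add_sub_cancel_right, map_sum, ← sum_linear_single]
  simp

theorem isHomogeneous_translate_affineTransform_X_sub_C [Infinite k]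
    (φ : (Fin 2 → k) ≃ᵃ[k] (Fin 2 → k)) (P : Fin 2 → k) (i : Fin 2) :
    (translate (φ P) (affineTransform φ (X i - C (P i)))).IsHomogeneous 1 := by
  rw [translate_affineTransform_X_sub_C]
  exact IsHomogeneous.sum _ _ _ fun j _ => by
    simpa using (isHomogeneous_C _ _).mul (isHomogeneous_X k j)

/-- The charts of the blowup depend on coordinates, so affine invariance is not visible in the
recursion; uniqueness supplies it once the transported number satisfies the local axioms. -/
theorem isLocalIntersectionNumber_affineTransform [IsAlgClosed k]
    (φ : (Fin 2 → k) ≃ᵃ[k] (Fin 2 → k)) (P : Fin 2 → k) :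
    IsLocalIntersectionNumber P fun f g =>
      blowupNumber (φ P) (affineTransform φ f) (affineTransform φ g) where
  zero _ _ h := blowupNumber_eq_zero fun h' => h (by
    rw [← h'.2, eval_affineTransform, AffineEquiv.symm_apply_apply])
  symm _ _ := blowupNumber_comm _ _ _
  mul hf h₁ h₂ := by
    have := IsAlgClosed.instInfinite (K := k)
    rw [affineTransform_mul, blowupNumber_mul_right _ (affineTransform_ne_zero φ hf)
      (affineTransform_ne_zero φ h₁) (affineTransform_ne_zero φ h₂)]
  add_mul h hf hg hG := by
    have hG' := affineTransform_ne_zero φ hG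
    rw [affineTransform_add, affineTransform_mul] at hG' ⊢
    exact blowupNumber_add_mul _ (affineTransform_ne_zero φ hf) (affineTransform_ne_zero φ hg) hG'
  axes := by
    have hne := fun i => affineTransform_ne_zero φ (X_sub_C_ne_zero i (P i))
    have hhom := isHomogeneous_translate_affineTransform_X_sub_C φ P
    rw [(blowupNumber_eq_mult_mul_mult_iff (hne 0) (hne 1)).2,
      mult_eq_of_isHomogeneous (hne 0) (hhom 0), mult_eq_of_isHomogeneous (hne 1) (hhom 1)]
    · rfl
    rw [haveCommonTangent_iff]
    rintro ⟨Q, hQ⟩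
    rw [mem_commonNearPoints_iff, lowestForm_eq_of_isHomogeneous (hne 0) (hhom 0),
      lowestForm_eq_of_isHomogeneous (hne 1) (hhom 1), translate_affineTransform_X_sub_C,
      translate_affineTransform_X_sub_C] at hQ
    -- A common tangent direction of the images of the axes would be killed by the invertible linear
    -- part.
    have hzero : φ.symm.linear (direction Q) = 0 := by
      funext i
      rw [← sum_linear_single]
      fin_cases i
      · simpa using hQ.1
      · simpa using hQ.2
    rw [LinearEquiv.map_eq_zero_iff] at hzero
    have h0 := congrFun hzero 0
    have h1 := congrFun hzero 1
    cases Q <;> simp [direction] at h0 h1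

theorem blowupNumber_affineTransform [IsAlgClosed k] (φ : (Fin 2 → k) ≃ᵃ[k] (Fin 2 → k))
    (P : Fin 2 → k) {f g : MvPolynomial (Fin 2) k} (hf : f ≠ 0) (hg : g ≠ 0) :
    blowupNumber P f g = blowupNumber (φ P) (affineTransform φ f) (affineTransform φ g) := by
  by_cases hs : ShareComponent P f g
  · rw [blowupNumber_eq_top hs, blowupNumber_eq_top (hs.affineTransform φ)]
  · exact (AgreeFinite.of_not_shareComponent (isLocalIntersectionNumber_blowupNumber P)
      (isLocalIntersectionNumber_affineTransform φ P) hf hg hs).1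

/-! ### Fulton's intersection number -/

theorem PlaneCurve.ne_zero (f : PlaneCurve k) : f.1 ≠ 0 := fun h => f.2 0 (by rw [h, C_0])

theorem isFultonIntersectionNumber_blowupNumber [IsAlgClosed k] :
    IsFultonIntersectionNumber fun (P : Fin 2 → k) (f g : PlaneCurve k) =>
      blowupNumber P f.1 g.1 where
  eq_top_iff _ f g := blowupNumber_eq_top_iff f.ne_zero g.ne_zero
  eq_zero_iff _ f g := blowupNumber_eq_zero_iff f.ne_zero g.ne_zero
  affine φ P f g f' g' hf hg := by
    rw [hf, hg]
    exact blowupNumber_affineTransform φ P f.ne_zero g.ne_zero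
  symm _ _ _ := blowupNumber_comm _ _ _
  mult_le P f g := mult_mul_mult_le_blowupNumber P f.ne_zero g.ne_zero
  eq_mult_iff _ f g := blowupNumber_eq_mult_mul_mult_iff f.ne_zero g.ne_zero
  mul P f f₁ f₂ g h := by
    rw [h]
    exact blowupNumber_mul_left P f₁.ne_zero f₂.ne_zero g.ne_zero
  add_mul P f g g' h hg := by
    have := g'.ne_zero
    rw [hg] at this ⊢
    exact (blowupNumber_add_mul P f.ne_zero g.ne_zero this).symm

theorem ne_C_iff {f : MvPolynomial (Fin 2) k} (hf : f ≠ 0) : (∀ c, f ≠ C c) ↔ ¬ IsUnit f := by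
  constructor
  · intro h hu
    obtain ⟨c, -, hc⟩ := isUnit_iff_eq_C_of_isReduced.1 hu
    exact h c hc
  · rintro h c rfl
    refine h (IsUnit.map C (IsUnit.mk0 c fun hc => hf ?_))
    rw [hc, C_0]

theorem not_isUnit_of_eval_eq_zero {P : Fin 2 → k} {f : MvPolynomial (Fin 2) k}
    (h : eval P f = 0) : ¬ IsUnit f := fun hu => (hu.map (eval P)).ne_zero h

open Classical in
/-- The extension by zero of an intersection number to constant polynomials. -/
def extendByZero (I : PlaneCurve k → PlaneCurve k → ℕ∞) (f g : MvPolynomial (Fin 2) k) : ℕ∞ :=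
  if h : (∀ c, f ≠ C c) ∧ ∀ c, g ≠ C c then I ⟨f, h.1⟩ ⟨g, h.2⟩ else 0

theorem extendByZero_coe (I : PlaneCurve k → PlaneCurve k → ℕ∞) (f g : PlaneCurve k) :
    extendByZero I f.1 g.1 = I f g := dif_pos ⟨f.2, g.2⟩

namespace IsFultonIntersectionNumber

variable {I : (Fin 2 → k) → PlaneCurve k → PlaneCurve k → ℕ∞}

/-- A unit is not a plane curve, so additivity does not apply to `u * g` directly. With a line `t`
that misses `P`, the product `g' t = g (u t)` has two factorizations into curves, and both `t` and
`u t` contribute 0. -/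
theorem mul_const (hI : IsFultonIntersectionNumber I) (P : Fin 2 → k) (f g g' : PlaneCurve k)
    {u : MvPolynomial (Fin 2) k} (hu : IsUnit u) (h : g'.1 = u * g.1) : I P f g' = I P f g := by
  set t : MvPolynomial (Fin 2) k := X 0 - C (P 0 + 1) with ht
  have ht0 : t ≠ 0 := X_sub_C_ne_zero _ _
  have htu : ¬ IsUnit t := (X_sub_C_irreducible _ _).not_isUnit
  have hte : eval P t ≠ 0 := by simp [ht]
  have hut0 : u * t ≠ 0 := mul_ne_zero hu.ne_zero ht0
  have hutu : ¬ IsUnit (u * t) := fun h => htu (isUnit_of_mul_isUnit_right h)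
  have hute : eval P (u * t) ≠ 0 := by
    rw [map_mul]
    exact mul_ne_zero (hu.map (eval P)).ne_zero hte
  have hg0 : g'.1 * t ≠ 0 := mul_ne_zero g'.ne_zero ht0
  have hgu : ¬ IsUnit (g'.1 * t) := fun h => htu (isUnit_of_mul_isUnit_right h)
  have h1 := hI.mul P ⟨g'.1 * t, (ne_C_iff hg0).2 hgu⟩ g' ⟨t, (ne_C_iff ht0).2 htu⟩ f rfl
  have h2 := hI.mul P ⟨g'.1 * t, (ne_C_iff hg0).2 hgu⟩ g ⟨u * t, (ne_C_iff hut0).2 hutu⟩ f (by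
    change g'.1 * t = g.1 * (u * t)
    rw [h]
    ring)
  rw [(hI.eq_zero_iff P ⟨t, _⟩ f).2 (Or.inl hte), add_zero] at h1
  rw [(hI.eq_zero_iff P ⟨u * t, _⟩ f).2 (Or.inl hute), add_zero] at h2
  rw [hI.symm, ← h1, h2, hI.symm]

theorem extendByZero_eq_zero (hI : IsFultonIntersectionNumber I) {P : Fin 2 → k}
    {f g : MvPolynomial (Fin 2) k} (h : eval P f ≠ 0 ∨ eval P g ≠ 0) :
    extendByZero (I P) f g = 0 := by
  rw [extendByZero]
  split_ifs with h'
  · exact (hI.eq_zero_iff P ⟨f, h'.1⟩ ⟨g, h'.2⟩).2 h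
  · rfl

theorem extendByZero_comm (hI : IsFultonIntersectionNumber I) (P : Fin 2 → k)
    (f g : MvPolynomial (Fin 2) k) : extendByZero (I P) f g = extendByZero (I P) g f := by
  rw [extendByZero, extendByZero]
  split_ifs with h1 h2 h2
  · exact hI.symm _ _ _
  · exact absurd h1.symm h2
  · exact absurd h2.symm h1
  · rfl

theorem extendByZero_isUnit_mul (hI : IsFultonIntersectionNumber I) (P : Fin 2 → k)
    (f : PlaneCurve k) {u g : MvPolynomial (Fin 2) k} (hu : IsUnit u) (hg : g ≠ 0) :
    extendByZero (I P) f.1 (u * g) = extendByZero (I P) f.1 g := by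
  have hue : eval P u ≠ 0 := (hu.map (eval P)).ne_zero
  by_cases hgP : eval P g = 0
  · have hgu := not_isUnit_of_eval_eq_zero hgP
    have hug : ¬ IsUnit (u * g) := fun h => hgu (isUnit_of_mul_isUnit_right h)
    rw [extendByZero_coe (I P) f ⟨g, (ne_C_iff hg).2 hgu⟩, extendByZero_coe (I P) f
      ⟨u * g, (ne_C_iff (mul_ne_zero hu.ne_zero hg)).2 hug⟩]
    exact hI.mul_const P f _ _ hu rfl
  · rw [hI.extendByZero_eq_zero (Or.inr hgP), hI.extendByZero_eq_zero (Or.inr _)]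
    rw [map_mul]
    exact mul_ne_zero hue hgP

theorem extendByZero_mul (hI : IsFultonIntersectionNumber I) (P : Fin 2 → k)
    {f g₁ g₂ : MvPolynomial (Fin 2) k} (hf : f ≠ 0) (h₁ : g₁ ≠ 0) (h₂ : g₂ ≠ 0) :
    extendByZero (I P) f (g₁ * g₂) = extendByZero (I P) f g₁ + extendByZero (I P) f g₂ := by
  by_cases hfP : eval P f = 0
  swap
  · rw [hI.extendByZero_eq_zero (Or.inl hfP), hI.extendByZero_eq_zero (Or.inl hfP),
      hI.extendByZero_eq_zero (Or.inl hfP), add_zero]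
  obtain ⟨f, rfl⟩ : ∃ f' : PlaneCurve k, f'.1 = f :=
    ⟨⟨f, (ne_C_iff hf).2 (not_isUnit_of_eval_eq_zero hfP)⟩, rfl⟩
  have hzero : ∀ {u : MvPolynomial (Fin 2) k}, IsUnit u → extendByZero (I P) f.1 u = 0 :=
    fun hu => hI.extendByZero_eq_zero (Or.inr (hu.map (eval P)).ne_zero)
  by_cases hu₁ : IsUnit g₁
  · rw [hI.extendByZero_isUnit_mul P f hu₁ h₂, hzero hu₁, zero_add]
  by_cases hu₂ : IsUnit g₂
  · rw [mul_comm, hI.extendByZero_isUnit_mul P f hu₂ h₁, hzero hu₂, add_zero]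
  obtain ⟨g₁, rfl⟩ : ∃ g' : PlaneCurve k, g'.1 = g₁ := ⟨⟨g₁, (ne_C_iff h₁).2 hu₁⟩, rfl⟩
  obtain ⟨g₂, rfl⟩ : ∃ g' : PlaneCurve k, g'.1 = g₂ := ⟨⟨g₂, (ne_C_iff h₂).2 hu₂⟩, rfl⟩
  have h₁₂ : ∀ c, g₁.1 * g₂.1 ≠ C c :=
    (ne_C_iff (mul_ne_zero h₁ h₂)).2 fun h => hu₁ (isUnit_of_mul_isUnit_left h)
  rw [extendByZero_coe, extendByZero_coe, extendByZero_coe (I P) f ⟨g₁.1 * g₂.1, h₁₂⟩, hI.symm,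
    hI.mul P _ g₁ g₂ f rfl, hI.symm P g₁, hI.symm P g₂]

theorem extendByZero_add_mul (hI : IsFultonIntersectionNumber I) (P : Fin 2 → k)
    {f g : MvPolynomial (Fin 2) k} (h : MvPolynomial (Fin 2) k) (hf : f ≠ 0) (hg : g ≠ 0)
    (hG : g + h * f ≠ 0) : extendByZero (I P) f (g + h * f) = extendByZero (I P) f g := by
  by_cases hfP : eval P f = 0
  swap
  · rw [hI.extendByZero_eq_zero (Or.inl hfP), hI.extendByZero_eq_zero (Or.inl hfP)]
  have hGe : eval P (g + h * f) = eval P g := by simp [hfP]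
  by_cases hgP : eval P g = 0
  swap
  · rw [hI.extendByZero_eq_zero (Or.inr hgP), hI.extendByZero_eq_zero (Or.inr (hGe ▸ hgP))]
  have hGP := hGe.trans hgP
  rw [extendByZero_coe (I P) ⟨f, (ne_C_iff hf).2 (not_isUnit_of_eval_eq_zero hfP)⟩
    ⟨g, (ne_C_iff hg).2 (not_isUnit_of_eval_eq_zero hgP)⟩, extendByZero_coe (I P)
    ⟨f, (ne_C_iff hf).2 (not_isUnit_of_eval_eq_zero hfP)⟩
    ⟨g + h * f, (ne_C_iff hG).2 (not_isUnit_of_eval_eq_zero hGP)⟩]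
  exact (hI.add_mul P _ _ _ h rfl).symm

theorem extendByZero_axes (hI : IsFultonIntersectionNumber I) (P : Fin 2 → k) :
    extendByZero (I P) (X 0 - C (P 0)) (X 1 - C (P 1)) = 1 := by
  have hc := fun i => (ne_C_iff (X_sub_C_ne_zero i (P i))).2
    (X_sub_C_irreducible i (P i)).not_isUnit
  set f : PlaneCurve k := ⟨X 0 - C (P 0), hc 0⟩ with hf
  set g : PlaneCurve k := ⟨X 1 - C (P 1), hc 1⟩ with hg
  have h1 : I P f g = ((mult P f.1 * mult P g.1 : ℕ) : ℕ∞) :=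
    (hI.eq_mult_iff P f g).2 (not_haveCommonTangent_axes P)
  have hmf : mult P f.1 = 1 := mult_X_sub_C P 0
  have hmg : mult P g.1 = 1 := mult_X_sub_C P 1
  rw [hmf, hmg, mul_one, Nat.cast_one] at h1
  exact (extendByZero_coe (I P) f g).trans h1

theorem isLocalIntersectionNumber (hI : IsFultonIntersectionNumber I) (P : Fin 2 → k) :
    IsLocalIntersectionNumber P (extendByZero (I P)) where
  zero _ _ h := hI.extendByZero_eq_zero (Or.inr h)
  symm _ _ := hI.extendByZero_comm P _ _
  mul := hI.extendByZero_mul P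
  add_mul := hI.extendByZero_add_mul P
  axes := hI.extendByZero_axes P

theorem eq_blowupNumber [IsAlgClosed k] (hI : IsFultonIntersectionNumber I) (P : Fin 2 → k)
    (f g : PlaneCurve k) : blowupNumber P f.1 g.1 = I P f g := by
  by_cases hs : ShareComponent P f.1 g.1
  · rw [blowupNumber_eq_top hs, (hI.eq_top_iff P f g).2 hs]
  · rw [(AgreeFinite.of_not_shareComponent (isLocalIntersectionNumber_blowupNumber P)
      (hI.isLocalIntersectionNumber P) f.ne_zero g.ne_zero hs).1, extendByZero_coe]

end IsFultonIntersectionNumber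

end PlaneIntersection

end

theorem theorem3p9 {k : Type*} [Field k] [IsAlgClosed k] [CharZero k] :
    (∃! I : (Fin 2 → k) → PlaneIntersection.PlaneCurve k → PlaneIntersection.PlaneCurve k → ℕ∞,
      PlaneIntersection.IsFultonIntersectionNumber I) ∧
    ∀ I : (Fin 2 → k) → PlaneIntersection.PlaneCurve k → PlaneIntersection.PlaneCurve k → ℕ∞,
      PlaneIntersection.IsFultonIntersectionNumber I →
        ∀ (f g : PlaneIntersection.PlaneCurve k) (P : Fin 2 → k),
          PlaneIntersection.blowupNumber P f.1 g.1 = I P f g := by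
  refine ⟨⟨_, PlaneIntersection.isFultonIntersectionNumber_blowupNumber, fun I hI => ?_⟩,
    fun I hI f g P => hI.eq_blowupNumber P f g⟩
  funext P f g
  exact (hI.eq_blowupNumber P f g).symm
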